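/- **Definitions.** A \emph{signature} $\Sigma$ is a finite set of symbols, each with an arity; here all arities are at most $2$. $T_\Sigma(V)$ is the set of terms over $\Sigma$ with variables in $V$, and $T_\Sigma=T_\Sigma(\emptyset)$. A \emph{deterministic tree automaton} (DTA) over $\Sigma$ is a tuple $A=\langle Q,F,\Sigma,\delta\rangle$ with a finite set $Q$ of states, a set $F\subseteq Q$ of accepting states, and a finite set $\delta$ of transitions $f(q_1,\dots,q_k)\to q$ (with $f\in\Sigma$ of arity $k$ and $q_1,\dots,q_k,q\in Q$) such that for each $f,q_1,\dots,q_k$ there is at most one such $q$. The partial function $A(\cdot)$ on $T_\Sigma$ is defined by $A(f(t_1,\dots,t_k))=q$ if $f(A(t_1),\dots,A(t_k))\to q$ is in $\delta$, and $\mathcal L(A)=\{t\in T_\Sigma\mid A(t)\in F\}$. A set $L\subseteq T_\Sigma$ is \emph{regular} if $L=\mathcal L(A)$ for some DTA $A$ over $\Sigma$. A \emph{set of terms with regular constraints} $\langle S,M\rangle$ over $\Sigma$ and a finite set $V$ of variables consists of a finite set $S\subseteq T_\Sigma(V)$ and a map $M$ that assigns a DTA over $\Sigma$ to each $x\in V$.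 Its set of instances is $$\mathcal L(\langle S,M\rangle)=\{\varphi(s)\mid s\in S,\ \varphi:V\to T_\Sigma,\ \varphi(x)\in\mathcal L(M(x))\text{ for all }x\in V\}.$$ RITRC is the following decision problem: given a signature $\Sigma$ with arities at most $2$ and a set $\langle S,M\rangle$ of terms with regular constraints over $\Sigma$ and a finite set $V$ of variables, all written out explicitly as a bit string, decide whether $\mathcal L(\langle S,M\rangle)$ is regular. **Theorem.** RITRC is EXPTIME-hard. That is, for every language $L\subseteq\{0,1\}^*$ that is decided by a deterministic Turing machine in time $2^{p(n)}$ for some polynomial $p$, there is a function $r$, computable in polynomial time by a deterministic Turing machine, that maps each $w\in\{0,1\}^*$ to (the code of) an instance $\langle S,M\rangle$ of RITRC such that $w\in L$ if and only if $\mathcal L(\langle S,M\rangle)$ is regular. -/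

import Mathlib

/-! ## Signatures, terms, tree automata -/

/-- A signature: finitely many symbols, each with an arity. The symbols are numbered
`0, …, card - 1`. -/
structure Signature where
  card : ℕ
  arity : Fin card → ℕ

/-- `STerm S V` is the set of terms over the signature `S` with variables in `V`. -/
inductive STerm (S : Signature) (V : Type) : Type
  | var : V → STerm S V
  | app : (f : Fin S.card) → (Fin (S.arity f) → STerm S V) → STerm S V

/-- The set of all (ground) terms over `S`. -/
abbrev GroundTerm (S : Signature) : Type := STerm S Empty

/-- The application of a substitution to a term. -/
def STerm.subst {S : Signature} {V W : Type} (φ : V → STerm S W) : STerm S V → STerm S W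
  | .var x => φ x
  | .app f ts => .app f fun i => (ts i).subst φ

/-- A transition `f(q₁, …, q_k) → q`, where `k` is the arity of `f` and the states are
numbered `0, …, n - 1`. -/
structure Transition (S : Signature) (n : ℕ) where
  symb : Fin S.card
  args : Fin (S.arity symb) → Fin n
  target : Fin n

/-- A deterministic (bottom-up, not necessarily complete) tree automaton over `S`.
The states are numbered `0, …, numStates - 1`, and the set of transitions is presented as a list.
For each symbol `f` and all states `q₁, …, q_k` there is at most one `q` such that
`f(q₁, …, q_k) → q` is a transition. -/
structure DTA (S : Signature) where
  numStates : ℕ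
  accept : Finset (Fin numStates)
  trans : List (Transition S numStates)
  det : ∀ (f : Fin S.card) (args : Fin (S.arity f) → Fin numStates) (q q' : Fin numStates),
    (⟨f, args, q⟩ : Transition S numStates) ∈ trans →
    (⟨f, args, q'⟩ : Transition S numStates) ∈ trans → q = q'

namespace DTA

variable {S : Signature}

/-- `A.Run t q` means that `A(t)` is defined and equal to `q`. -/
inductive Run (A : DTA S) : GroundTerm S → Fin A.numStates → Prop
  | app (f : Fin S.card) (ts : Fin (S.arity f) → GroundTerm S)
      (args : Fin (S.arity f) → Fin A.numStates) (q : Fin A.numStates)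
      (hτ : (⟨f, args, q⟩ : Transition S A.numStates) ∈ A.trans)
      (hts : ∀ i, Run A (ts i) (args i)) : Run A (.app f ts) q

/-- The language recognized by `A`. -/
def language (A : DTA S) : Set (GroundTerm S) :=
  {t | ∃ q ∈ A.accept, A.Run t q}

end DTA

/-- A set of ground terms is regular if it is recognized by some DTA. -/
def IsRegularTreeLanguage {S : Signature} (L : Set (GroundTerm S)) : Prop :=
  ∃ A : DTA S, L = A.language

/-! ## Sets of terms with regular constraints -/

/-- A set of terms with regular constraints `⟨S, M⟩`, together with its signature, all of whose
symbols have arity at most two. The variables are numbered `0, …, numVars - 1`, the finite set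
`S` of terms is presented as a list, and `constr` is the regular constraint `M`. -/
structure ConstrainedTerms where
  sig : Signature
  arity_le_two : ∀ f, sig.arity f ≤ 2
  numVars : ℕ
  terms : List (STerm sig (Fin numVars))
  constr : Fin numVars → DTA sig

namespace ConstrainedTerms

/-- A solution of the regular constraint assigns to *every* variable a ground term in the language
of the automaton that constrains it. -/
def IsSolution (I : ConstrainedTerms) (φ : Fin I.numVars → GroundTerm I.sig) : Prop :=
  ∀ x, φ x ∈ (I.constr x).language

/-- The set of instances of `⟨S, M⟩`. -/
def language (I : ConstrainedTerms) : Set (GroundTerm I.sig) :=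
  {t | ∃ φ : Fin I.numVars → GroundTerm I.sig, ∃ s ∈ I.terms, I.IsSolution φ ∧ t = s.subst φ}

end ConstrainedTerms

/-! ## The encoding of instances as bit strings

An instance is first written as a list of natural numbers, and then each number `n` is written as
`1ⁿ0`. All numbers are either constants, or lengths of sequences that are written out, or indices
below such lengths, or numbers of states, or arities (which are at most two), so that the length
of the code is polynomially related to the size (sum of the size of the signature, the sizes of
the terms and the sizes of the automata) of the instance. -/

/-- The concatenation of `g 0, …, g (n - 1)`. -/
def catFin {n : ℕ} (g : Fin n → List ℕ) : List ℕ :=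
  (List.ofFn g).flatten

/-- The code of a list: its length, followed by the codes of its members. -/
def codeList {α : Type} (c : α → List ℕ) (l : List α) : List ℕ :=
  l.length :: l.flatMap c

/-- The number of symbols, followed by their arities. -/
def Signature.code (S : Signature) : List ℕ :=
  S.card :: catFin fun f => [S.arity f]

/-- Terms in prefix notation. -/
def STerm.code {S : Signature} {v : ℕ} : STerm S (Fin v) → List ℕ
  | .var x => [0, (x : ℕ)]
  | .app f ts => 1 :: (f : ℕ) :: catFin fun i => (ts i).code

/-- The symbol, the states on the left-hand side, the state on the right-hand side. -/
def Transition.code {S : Signature} {n : ℕ} (τ : Transition S n) : List ℕ :=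
  (τ.symb : ℕ) :: ((catFin fun i => [(τ.args i : ℕ)]) ++ [(τ.target : ℕ)])

/-- The number of states, one bit per state telling whether it is accepting, the transitions. -/
def DTA.code {S : Signature} (A : DTA S) : List ℕ :=
  A.numStates ::
    ((catFin fun q => [if q ∈ A.accept then 1 else 0]) ++ codeList Transition.code A.trans)

/-- The signature, the number of variables, the automata, the terms. -/
def ConstrainedTerms.code (I : ConstrainedTerms) : List ℕ :=
  I.sig.code ++ I.numVars ::
    ((catFin fun x => (I.constr x).code) ++ codeList STerm.code I.terms)

/-- The natural number `n` as the bit string `1ⁿ0`. -/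
def natBits (n : ℕ) : List Bool :=
  List.replicate n true ++ [false]

/-- The bit string that encodes an instance. -/
def ConstrainedTerms.encode (I : ConstrainedTerms) : List Bool :=
  I.code.flatMap natBits

/-! The encoding is injective. -/

theorem catFin_succ {n : ℕ} (g : Fin (n + 1) → List ℕ) :
    catFin g = g 0 ++ catFin fun i => g i.succ := by
  simp [catFin, List.ofFn_succ]

theorem catFin_cancel {n : ℕ} {α : Type} (c : α → List ℕ) (g g' : Fin n → α)
    (hc : ∀ i r r', c (g i) ++ r = c (g' i) ++ r' → g i = g' i ∧ r = r') (r r' : List ℕ)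
    (h : (catFin fun i => c (g i)) ++ r = (catFin fun i => c (g' i)) ++ r') :
    g = g' ∧ r = r' := by
  induction n generalizing r r' with
  | zero => exact ⟨funext fun i => i.elim0, by simpa [catFin] using h⟩
  | succ n ih =>
    rw [catFin_succ, catFin_succ, List.append_assoc, List.append_assoc] at h
    obtain ⟨h0, h1⟩ := hc 0 _ _ h
    obtain ⟨h2, h3⟩ := ih (fun i => g i.succ) (fun i => g' i.succ) (fun i => hc i.succ) _ _ h1
    refine ⟨funext fun i => ?_, h3⟩
    induction i using Fin.cases with
    | zero => exact h0
    | succ i => exact congrFun h2 i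

theorem codeList_cancel {α : Type} (c : α → List ℕ)
    (hc : ∀ a b r r', c a ++ r = c b ++ r' → a = b ∧ r = r') (l l' : List α) (r r' : List ℕ)
    (h : codeList c l ++ r = codeList c l' ++ r') : l = l' ∧ r = r' := by
  simp only [codeList, List.cons_append, List.cons.injEq] at h
  obtain ⟨hl, h⟩ := h
  induction l generalizing l' with
  | nil =>
    cases l' with
    | nil => exact ⟨rfl, by simpa using h⟩
    | cons => simp at hl
  | cons a l ih =>
    cases l' with
    | nil => simp at hl
    | cons a' l' =>
      simp only [List.flatMap_cons, List.append_assoc] at h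
      replace h := hc _ _ _ _ h
      obtain ⟨rfl, h⟩ := h
      replace h := ih l' (by simpa using hl) h
      obtain ⟨rfl, h⟩ := h
      exact ⟨rfl, h⟩

theorem Signature.code_cancel (S S' : Signature) (r r' : List ℕ)
    (h : S.code ++ r = S'.code ++ r') : S = S' ∧ r = r' := by
  obtain ⟨n, a⟩ := S
  obtain ⟨n', a'⟩ := S'
  simp only [Signature.code, List.cons_append, List.cons.injEq] at h
  obtain ⟨rfl, h⟩ := h
  replace h := catFin_cancel (fun k => [k]) a a' (by intro i r r' h; simpa using h) r r' h
  obtain ⟨rfl, h⟩ := h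
  exact ⟨rfl, h⟩

theorem STerm.code_cancel {S : Signature} {v : ℕ} (s s' : STerm S (Fin v)) (r r' : List ℕ)
    (h : s.code ++ r = s'.code ++ r') : s = s' ∧ r = r' := by
  induction s generalizing s' r r' with
  | var x =>
    cases s' with
    | var y =>
      simp only [STerm.code, List.cons_append, List.cons.injEq, Fin.val_inj] at h
      exact ⟨by rw [h.2.1], by simpa using h.2.2⟩
    | app => simp [STerm.code] at h
  | app f ts ih =>
    cases s' with
    | var => simp [STerm.code] at h
    | app f' ts' =>
      simp only [STerm.code, List.cons_append, List.cons.injEq, Fin.val_inj, true_and] at h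
      obtain ⟨rfl, h⟩ := h
      replace h := catFin_cancel STerm.code ts ts' (fun i => ih i (ts' i)) r r' h
      obtain ⟨rfl, h⟩ := h
      exact ⟨rfl, h⟩

theorem Transition.code_cancel {S : Signature} {n : ℕ} (τ τ' : Transition S n) (r r' : List ℕ)
    (h : τ.code ++ r = τ'.code ++ r') : τ = τ' ∧ r = r' := by
  obtain ⟨f, a, q⟩ := τ
  obtain ⟨f', a', q'⟩ := τ'
  simp only [Transition.code, List.cons_append, List.cons.injEq, Fin.val_inj] at h
  obtain ⟨rfl, h⟩ := h
  rw [List.append_assoc, List.append_assoc] at h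
  replace h := catFin_cancel (fun k : Fin n => [(k : ℕ)]) a a'
    (by intro i r r' h; simpa [Fin.val_inj] using h) _ _ h
  obtain ⟨rfl, h⟩ := h
  simp only [List.cons_append, List.nil_append, List.cons.injEq, Fin.val_inj] at h
  obtain ⟨rfl, h⟩ := h
  exact ⟨rfl, h⟩

theorem DTA.code_cancel {S : Signature} (A A' : DTA S) (r r' : List ℕ)
    (h : A.code ++ r = A'.code ++ r') : A = A' ∧ r = r' := by
  obtain ⟨n, F, δ, hd⟩ := A
  obtain ⟨n', F', δ', hd'⟩ := A'
  simp only [DTA.code, List.cons_append, List.cons.injEq] at h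
  obtain ⟨rfl, h⟩ := h
  rw [List.append_assoc, List.append_assoc] at h
  replace h := catFin_cancel (fun k : ℕ => [k])
    (fun q => if q ∈ F then 1 else 0) (fun q => if q ∈ F' then 1 else 0)
    (by intro i r r' h; simpa using h) _ _ h
  obtain ⟨hF, h⟩ := h
  replace h := codeList_cancel _ Transition.code_cancel _ _ _ _ h
  obtain ⟨rfl, h⟩ := h
  have hF' : F = F' := by
    ext q
    have := congrFun hF q
    by_cases h1 : q ∈ F <;> by_cases h2 : q ∈ F' <;> simp_all
  subst hF'
  exact ⟨rfl, h⟩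

theorem natBits_cancel (m n : ℕ) (r r' : List Bool)
    (h : natBits m ++ r = natBits n ++ r') : m = n ∧ r = r' := by
  induction m generalizing n with
  | zero => cases n <;> simp_all [natBits, List.replicate_succ]
  | succ m ih =>
    cases n with
    | zero => simp [natBits, List.replicate_succ] at h
    | succ n =>
      simp only [natBits, List.replicate_succ, List.cons_append, List.cons.injEq, true_and] at h
      replace h := ih n h
      obtain ⟨rfl, h⟩ := h
      exact ⟨rfl, h⟩

theorem flatMap_natBits_injective : Function.Injective fun l : List ℕ => l.flatMap natBits := by
  intro l l' h
  induction l generalizing l' with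
  | nil => cases l' <;> simp_all [natBits]
  | cons a l ih =>
    cases l' with
    | nil => simp [natBits] at h
    | cons a' l' =>
      simp only [List.flatMap_cons] at h
      replace h := natBits_cancel _ _ _ _ h
      obtain ⟨rfl, h⟩ := h
      rw [ih h]

theorem ConstrainedTerms.encode_injective : Function.Injective ConstrainedTerms.encode := by
  intro I I' h
  replace h : I.code = I'.code := flatMap_natBits_injective h
  obtain ⟨S, hS, v, ts, M⟩ := I
  obtain ⟨S', hS', v', ts', M'⟩ := I'
  simp only [ConstrainedTerms.code] at h
  replace h := Signature.code_cancel _ _ _ _ h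
  obtain ⟨rfl, h⟩ := h
  simp only [List.cons.injEq] at h
  obtain ⟨rfl, h⟩ := h
  replace h := catFin_cancel DTA.code M M' (fun i => DTA.code_cancel _ _) _ _ h
  obtain ⟨rfl, h⟩ := h
  obtain ⟨rfl, -⟩ := codeList_cancel _ STerm.code_cancel ts ts' [] [] (by simpa using h)
  rfl

/-! ## Decision problems and EXPTIME-hardness -/

/-- A decision problem: a set of instances, an injective encoding of them as bit strings, and the
set of yes-instances. -/
structure DecisionProblem where
  Inst : Type
  encode : Inst → List Bool
  encode_injective : Function.Injective encode
  Yes : Inst → Prop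

/-- A language `L ⊆ {0,1}*` is in EXPTIME if its characteristic function is computed by a
(deterministic, multi-stack) Turing machine within `2 ^ p(n)` steps on all inputs of length `n`,
for some polynomial `p`. -/
def InEXPTIME (L : Language Bool) : Prop :=
  ∃ χ : List Bool → Bool, (∀ w, χ w = true ↔ w ∈ L) ∧
    ∃ (M : Turing.TM2ComputableInTime (id : List Bool → List Bool) Computability.encodeBool χ)
      (p : Polynomial ℕ), ∀ n, M.time n ≤ 2 ^ p.eval n

/-- `L` is polynomial-time many-one reducible to the decision problem `P`. -/
def PolyTimeReducible (L : Language Bool) (P : DecisionProblem) : Prop :=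
  ∃ r : List Bool → P.Inst,
    Nonempty (Turing.TM2ComputableInPolyTime (id : List Bool → List Bool) P.encode r) ∧
      ∀ w, w ∈ L ↔ P.Yes (r w)

/-- A decision problem is EXPTIME-hard if every language in EXPTIME is polynomial-time many-one
reducible to it. -/
def EXPTIMEHard (P : DecisionProblem) : Prop :=
  ∀ L : Language Bool, InEXPTIME L → PolyTimeReducible L P

/-- Regularity of the instances of a set of terms with regular constraints. -/
def RITRC : DecisionProblem where
  Inst := ConstrainedTerms
  encode := ConstrainedTerms.encode
  encode_injective := ConstrainedTerms.encode_injective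
  Yes I := IsRegularTreeLanguage I.language

/-!
The acceptance problem for exponential time is reduced to the question whether `N` given complete
tree automata together accept all trees, and the latter to RITRC.

*From covering to regularity.* Let `A_0, …, A_{N-1}` be complete automata, and consider the terms
`f(x_j, y)` with `x_j` constrained by `A_j`, for all `j`, and `f(y, f(z, z))` with `y` and `z`
unconstrained. If each tree is accepted by some `A_j`, then the instances are all trees with the
root `f`, which form a regular language. If no `A_j` accepts `t₀`, then the instances
`f(t₀, f(s, s'))` are those with `s = s'`, and by the pigeonhole principle no automaton can tell
them from the others (`isRegular_coverInst_iff`).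

*From computations to covering.* A Turing machine is first replaced by a machine with several
stacks that performs one stack operation per step (`exists_stackMachine`). A *proof tree* derives
claims such as "the state at time `T` is `q`" and "the symbol at depth `D` of the stack `k` at time
`T` is `c`", by inference rules that express a step of the machine. The numbers `T` and `D` have
`N` bits, where `N` is polynomial in the length of the input, so they cannot be part of the state of
an automaton of polynomial size. Therefore the number in a claim is written out bit by bit in the
tree after each inference, and the `j`-th automaton checks only the `j`-th bit: it carries this bit
along, and computes the `j`-th bit of `T ± 1` from it and from the conjunction of the lower bits,
which it can see since all bits are written out (`BitView`). It follows that a tree on which no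
automaton finds an error proves a true claim (`exists_claim`), and conversely all true claims, with
numbers that do not overflow, have such proof trees (`provable_cfg`). If each automaton
accepts the trees on which it finds an error and those that claim something other than rejection,
then the automata together accept all trees iff the machine does not reject (`forall_tree_iff`). The
input enters through symbols that are numbered by the input cells, on which each automaton acts as
the letter in the cell prescribes. The cells have to be read in order, which makes sure that the
number `D` in the claim is the number of the cell.

*The reduction is computable in polynomial time.* The automata are given by a table that does not
depend on the input, except that the symbols have an index `i < N`, on which the `j`-th automaton
acts according to the comparison of `i` to `j` and to the `i`-th letter of the input (`AutTable`).
Hence their codes can be written by nested loops over the letters. These are expressed in a small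
language of structured stack programs with explicit running times, which is compiled to Turing
machines (`StackProg.computableInPolyTime`).
-/

/-! ### Complete automata on binary trees -/

/-- The signature with one constant, the symbol `0`, and `n` binary symbols `1, …, n`. -/
abbrev binSig (n : ℕ) : Signature where
  card := n + 1
  arity
    | ⟨0, _⟩ => 0
    | ⟨_ + 1, _⟩ => 2

namespace binSig

variable {n : ℕ}

/-- The binary symbol `g + 1`. -/
def symb (g : Fin n) : Fin (binSig n).card := g.succ

/-- The ground terms over `binSig n` are the binary trees with labels in `Fin n`. -/
def toTree : GroundTerm (binSig n) → BinaryTree (Fin n)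
  | .app ⟨0, _⟩ _ => .nil
  | .app ⟨g + 1, h⟩ ts =>
    .node ⟨g, Nat.lt_of_succ_lt_succ h⟩ (toTree (ts (0 : Fin 2))) (toTree (ts (1 : Fin 2)))

/-- A term with a binary symbol at the root. -/
def node {V : Type} (g : Fin n) (l r : STerm (binSig n) V) : STerm (binSig n) V :=
  .app (symb g) (![l, r] : Fin 2 → STerm (binSig n) V)

/-- The constant, as a term. -/
def leaf {V : Type} : STerm (binSig n) V :=
  .app (0 : Fin (n + 1)) (Fin.elim0 : Fin 0 → STerm (binSig n) V)

/-- The ground term of a binary tree. -/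
def ofTree : BinaryTree (Fin n) → GroundTerm (binSig n)
  | .nil => leaf
  | .node g l r => node g (ofTree l) (ofTree r)

theorem toTree_node (g : Fin n) (l r : GroundTerm (binSig n)) :
    toTree (node g l r) = .node g (toTree l) (toTree r) := rfl

theorem toTree_ofTree (t : BinaryTree (Fin n)) : toTree (ofTree t) = t := by
  induction t with
  | nil => rfl
  | node g l r hl hr => rw [ofTree, toTree_node, hl, hr]

theorem app_zero_eq_leaf {V : Type} (h : 0 < n + 1) (ts) :
    (STerm.app (S := binSig n) (V := V) ⟨0, h⟩ ts) = leaf := by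
  unfold leaf
  congr 1
  funext i
  exact Fin.elim0 i

theorem app_succ_eq_node {V : Type} (g : ℕ) (h : g + 1 < n + 1)
    (ts : Fin 2 → STerm (binSig n) V) :
    (STerm.app (S := binSig n) ⟨g + 1, h⟩ ts) =
      node ⟨g, Nat.lt_of_succ_lt_succ h⟩ (ts 0) (ts 1) := by
  unfold node symb
  congr 1
  funext i
  match i with
  | ⟨0, _⟩ => rfl
  | ⟨1, _⟩ => rfl

theorem ofTree_toTree : ∀ t : GroundTerm (binSig n), ofTree (toTree t) = t
  | .app ⟨0, h⟩ ts => (app_zero_eq_leaf h ts).symm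
  | .app ⟨g + 1, h⟩ ts => by
    rw [app_succ_eq_node g h ts, toTree_node, ofTree,
      ofTree_toTree (ts (0 : Fin 2)), ofTree_toTree (ts (1 : Fin 2))]

theorem subst_node {V W : Type} (φ : V → STerm (binSig n) W) (g : Fin n)
    (l r : STerm (binSig n) V) : (node g l r).subst φ = node g (l.subst φ) (r.subst φ) := by
  unfold node
  refine congrArg (STerm.app _) (funext fun i => ?_)
  match i with
  | ⟨0, _⟩ => rfl
  | ⟨1, _⟩ => rfl

theorem node_injective {g : Fin n} {V : Type} {l r l' r' : STerm (binSig n) V}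
    (h : node g l r = node g l' r') : l = l' ∧ r = r' := by
  unfold node at h
  have h := eq_of_heq (STerm.app.inj h).2
  exact ⟨congrFun h (0 : Fin 2), congrFun h (1 : Fin 2)⟩

end binSig

/-- The value of a tree in an algebra with one constant and a binary operation for each label. -/
def BinaryTree.eval {α β : Type} (c : β) (δ : α → β → β → β) : BinaryTree α → β
  | .nil => c
  | .node g l r => δ g (l.eval c δ) (r.eval c δ)

namespace binSig

variable {n K : ℕ}

/-- The transition `leaf → q`. -/
def leafTrans (q : Fin K) : Transition (binSig n) K where
  symb := (0 : Fin (n + 1))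
  args := (Fin.elim0 : Fin 0 → Fin K)
  target := q

/-- The transition `g(a, b) → q`. -/
def nodeTrans (g : Fin n) (a b q : Fin K) : Transition (binSig n) K where
  symb := symb g
  args := (![a, b] : Fin 2 → Fin K)
  target := q

theorem nodeTrans_inj {g g' : Fin n} {a b q a' b' q' : Fin K}
    (h : nodeTrans g a b q = nodeTrans g' a' b' q') : g = g' ∧ a = a' ∧ b = b' ∧ q = q' := by
  obtain ⟨h1, h2, h3⟩ := Transition.mk.inj h
  obtain rfl : g = g' := Fin.succ_injective n h1
  have h2 := eq_of_heq h2
  exact ⟨rfl, congrFun h2 (0 : Fin 2), congrFun h2 (1 : Fin 2), h3⟩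

/-- All transitions of the complete deterministic automaton with the transition functions
`c` and `δ`. -/
def transList (c : Fin K) (δ : Fin n → Fin K → Fin K → Fin K) :
    List (Transition (binSig n) K) :=
  leafTrans c :: (List.finRange n).flatMap fun g => (List.finRange K).flatMap fun a =>
    (List.finRange K).map fun b => nodeTrans g a b (δ g a b)

theorem leafTrans_ne_nodeTrans (g : Fin n) (a b q c : Fin K) :
    leafTrans c ≠ nodeTrans g a b q := by
  intro h
  exact (Fin.succ_ne_zero g) (Transition.mk.inj h).1.symm

theorem leafTrans_mem (c : Fin K) (δ : Fin n → Fin K → Fin K → Fin K) (q : Fin K) :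
    leafTrans q ∈ transList c δ ↔ q = c := by
  simp only [transList, List.mem_cons, List.mem_flatMap, List.mem_map, List.mem_finRange,
    true_and]
  constructor
  · rintro (h | ⟨g, a, b, h⟩)
    · exact (Transition.mk.inj h).2.2
    · exact absurd h.symm (leafTrans_ne_nodeTrans _ _ _ _ _)
  · rintro rfl
    exact Or.inl rfl

theorem nodeTrans_mem (c : Fin K) (δ : Fin n → Fin K → Fin K → Fin K) (g : Fin n)
    (a b q : Fin K) : nodeTrans g a b q ∈ transList c δ ↔ q = δ g a b := by
  simp only [transList, List.mem_cons, List.mem_flatMap, List.mem_map, List.mem_finRange,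
    true_and]
  constructor
  · rintro (h | ⟨g, a, b, h⟩)
    · exact absurd h.symm (leafTrans_ne_nodeTrans _ _ _ _ _)
    · obtain ⟨rfl, rfl, rfl, rfl⟩ := nodeTrans_inj h
      rfl
  · rintro rfl
    exact Or.inr ⟨g, a, b, rfl⟩

theorem mk_zero_eq (h : 0 < n + 1) (args : Fin 0 → Fin K) (q : Fin K) :
    (⟨⟨0, h⟩, args, q⟩ : Transition (binSig n) K) = leafTrans q := by
  unfold leafTrans
  congr 1
  funext i
  exact Fin.elim0 i

theorem mk_succ_eq (g : ℕ) (h : g + 1 < n + 1) (args : Fin 2 → Fin K) (q : Fin K) :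
    (⟨⟨g + 1, h⟩, args, q⟩ : Transition (binSig n) K) =
      nodeTrans ⟨g, Nat.lt_of_succ_lt_succ h⟩ (args 0) (args 1) q := by
  unfold nodeTrans symb
  congr 1
  funext i
  match i with
  | ⟨0, _⟩ => rfl
  | ⟨1, _⟩ => rfl

/-- The complete deterministic automaton with the transition functions `c` and `δ`, and the
accepting states `F`. -/
def dta (c : Fin K) (δ : Fin n → Fin K → Fin K → Fin K) (F : Finset (Fin K)) :
    DTA (binSig n) where
  numStates := K
  accept := F
  trans := transList c δ
  det := by
    rintro ⟨_ | g, h⟩ args q q' h1 h2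
    · rw [mk_zero_eq h args, leafTrans_mem] at h1 h2
      rw [h1, h2]
    · rw [mk_succ_eq g h args, nodeTrans_mem] at h1 h2
      rw [h1, h2]

theorem run_dta (c : Fin K) (δ : Fin n → Fin K → Fin K → Fin K) (F : Finset (Fin K)) :
    ∀ t : GroundTerm (binSig n), (dta c δ F).Run t ((toTree t).eval c δ)
  | .app ⟨0, h⟩ ts => by
    refine DTA.Run.app _ _ (Fin.elim0 : Fin 0 → Fin K) _ ?_ (fun i => Fin.elim0 i)
    have h1 : leafTrans c ∈ transList c δ := (leafTrans_mem _ _ _).2 rfl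
    rw [← mk_zero_eq h (Fin.elim0 : Fin 0 → Fin K)] at h1
    exact h1
  | .app ⟨g + 1, h⟩ ts => by
    refine DTA.Run.app _ _
      (fun i : Fin 2 => ((toTree (ts i)).eval c δ : Fin K)) _ ?_ (fun i => run_dta c δ F (ts i))
    have h1 := (nodeTrans_mem c δ ⟨g, Nat.lt_of_succ_lt_succ h⟩ _ _ _).2
      (rfl : _ = δ ⟨g, Nat.lt_of_succ_lt_succ h⟩ ((toTree (ts (0 : Fin 2))).eval c δ)
        ((toTree (ts (1 : Fin 2))).eval c δ))
    rw [← mk_succ_eq g h (fun i : Fin 2 => ((toTree (ts i)).eval c δ : Fin K))] at h1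
    exact h1

end binSig

theorem DTA.Run.unique {S : Signature} {A : DTA S} {t : GroundTerm S} {q q' : Fin A.numStates}
    (h : A.Run t q) (h' : A.Run t q') : q = q' := by
  induction h generalizing q' with
  | app f ts args q hτ hts ih =>
    cases h' with
    | app _ _ args' _ hτ' hts' =>
      obtain rfl : args = args' := funext fun i => ih i (hts' i)
      exact A.det _ _ _ _ hτ hτ'

theorem binSig.mem_language_dta {n K : ℕ} (c : Fin K) (δ : Fin n → Fin K → Fin K → Fin K)
    (F : Finset (Fin K)) (t : GroundTerm (binSig n)) :
    t ∈ (dta c δ F).language ↔ (toTree t).eval c δ ∈ F := by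
  constructor
  · rintro ⟨q, hq, hr⟩
    have h := (run_dta c δ F t).unique hr
    exact h ▸ hq
  · intro h
    exact ⟨_, h, run_dta c δ F t⟩

/-! ### Covering all trees by automata as a regularity problem -/

/-- Given `N ≥ 2` complete automata with the same states and the same accepting states, the
instance of RITRC with the terms `f(x₂ⱼ, x₁)`, `j < N`, and `f(x₁, f(x₃, x₃))`, where `x₂ⱼ` is
constrained by the `j`-th automaton, and the variables with odd numbers are unconstrained: their
automata differ from the given ones in that all states are accepting. -/
def coverInst {n K N : ℕ} (hn : 0 < n) (hN : 2 ≤ N) (c : Fin K)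
    (δ : Fin N → Fin n → Fin K → Fin K → Fin K) (F : Finset (Fin K)) : ConstrainedTerms where
  sig := binSig n
  arity_le_two := by
    rintro ⟨_ | g, h⟩
    · exact Nat.zero_le 2
    · exact le_refl 2
  numVars := N * 2
  terms := (List.ofFn fun j : Fin N =>
      binSig.node ⟨0, hn⟩ (.var ⟨j * 2 + 0, by omega⟩) (.var ⟨1, by omega⟩)) ++
    [binSig.node ⟨0, hn⟩ (.var ⟨1, by omega⟩)
      (binSig.node ⟨0, hn⟩ (.var ⟨3, by omega⟩) (.var ⟨3, by omega⟩))]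
  constr x := binSig.dta c (δ ⟨x / 2, by omega⟩) (if (x : ℕ) % 2 = 0 then F else Finset.univ)

/-- No deterministic automaton recognizes the terms `f(t₀, f(s, s))` among the `f(t₀, f(s, s'))`:
it would reach the same state on two different trees `s`, `s'`. -/
theorem binSig.not_regular_diagonal {n : ℕ} (g : Fin n) (t₀ : GroundTerm (binSig n))
    (L : Set (GroundTerm (binSig n)))
    (hL : ∀ s s', binSig.node g t₀ (binSig.node g s s') ∈ L ↔ s = s') :
    ¬ IsRegularTreeLanguage L := by
  rintro ⟨A, rfl⟩
  have key : ∀ s, ∃ q, A.Run s q := by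
    intro s
    obtain ⟨q, -, h⟩ := (hL s s).2 rfl
    cases h with
    | app _ _ args _ _ hts =>
      have h1 := hts (1 : Fin 2)
      change A.Run (binSig.node g s s) _ at h1
      generalize args (1 : Fin 2) = q1 at h1
      cases h1 with
      | app _ _ args' _ _ hts' => exact ⟨_, hts' (0 : Fin 2)⟩
  choose ρ hρ using key
  -- infinitely many trees, finitely many states
  let comb : ℕ → BinaryTree (Fin n) := fun k => Nat.rec .nil (fun _ t => .node g t .nil) k
  have hcomb : Function.Injective comb := by
    intro a
    induction a with
    | zero =>
      rintro (_ | b) h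
      · rfl
      · cases h
    | succ a ih =>
      rintro (_ | b) h
      · cases h
      · rw [ih (BinaryTree.node.inj h).2.1]
  obtain ⟨a, b, hab, h⟩ := Finite.exists_ne_map_eq_of_infinite fun k => ρ (ofTree (comb k))
  set s := ofTree (comb a) with hs
  set s' := ofTree (comb b) with hs'
  have hne : s ≠ s' := by
    intro h
    apply hab
    apply hcomb
    rw [← toTree_ofTree (comb a), ← toTree_ofTree (comb b), ← hs, ← hs', h]
  apply hne
  rw [← hL s s']
  obtain ⟨q, hq, hr⟩ := (hL s s).2 rfl
  refine ⟨q, hq, ?_⟩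
  cases hr with
  | app _ _ args _ hτ hts =>
    refine DTA.Run.app _ _ args _ hτ ?_
    intro i
    match i with
    | ⟨0, _⟩ => exact hts (0 : Fin 2)
    | ⟨1, _⟩ =>
      have h1 := hts (1 : Fin 2)
      change A.Run (binSig.node g s s) (args (1 : Fin 2)) at h1
      change A.Run (binSig.node g s s') (args (1 : Fin 2))
      generalize args (1 : Fin 2) = q1 at h1
      cases h1 with
      | app _ _ args' _ hτ' hts' =>
        refine DTA.Run.app _ _ args' _ hτ' ?_
        intro i
        match i with
        | ⟨0, _⟩ => exact hts' (0 : Fin 2)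
        | ⟨1, _⟩ =>
          have h2 : args' (1 : Fin 2) = ρ s' := ((hts' (1 : Fin 2)).unique (hρ s)).trans h
          exact h2.symm ▸ hρ s'

/-- The instance `coverInst` is regular iff each tree is accepted by one of the automata. The
condition that the constant is accepted makes sure that the constraints have a solution. -/
theorem isRegular_coverInst_iff {n K N : ℕ} (hn : 0 < n) (hN : 2 ≤ N) (c : Fin K)
    (δ : Fin N → Fin n → Fin K → Fin K → Fin K) (F : Finset (Fin K)) (hc : c ∈ F) :
    IsRegularTreeLanguage (coverInst hn hN c δ F).language ↔
      ∀ t : BinaryTree (Fin n), ∃ j, t.eval c (δ j) ∈ F := by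
  set I := coverInst hn hN c δ F with hI
  set f : Fin n := ⟨0, hn⟩
  have hlt : ∀ j : Fin N, (j : ℕ) * 2 + 0 < N * 2 := fun j => by omega
  have hsol : ∀ φ : Fin (N * 2) → GroundTerm (binSig n), I.IsSolution φ ↔
      ∀ j : Fin N, (binSig.toTree (φ ⟨j * 2 + 0, hlt j⟩)).eval c (δ j) ∈ F := by
    intro φ
    have h1 : ∀ x : Fin (N * 2), φ x ∈ (I.constr x).language ↔
        (binSig.toTree (φ x)).eval c (δ ⟨x / 2, by omega⟩) ∈
          (if (x : ℕ) % 2 = 0 then F else Finset.univ) :=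
      fun x => binSig.mem_language_dta _ _ _ _
    constructor
    · intro h j
      have h2 := (h1 _).1 (h (⟨j * 2 + 0, hlt j⟩ : Fin (N * 2)))
      have h3 : (⟨((j : ℕ) * 2 + 0) / 2, by omega⟩ : Fin N) = j := Fin.ext (by simp)
      simpa [h3] using h2
    · intro h x
      refine (h1 x).2 ?_
      split_ifs with hx
      · have h2 := h ⟨x / 2, by omega⟩
        have h3 : (⟨(x : ℕ) / 2 * 2 + 0, by omega⟩ : Fin (N * 2)) = x := Fin.ext (by simp; omega)
        simp only [h3] at h2
        exact h2
      · exact Finset.mem_univ _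
  have hmem : ∀ t : GroundTerm (binSig n), t ∈ I.language ↔
      ∃ φ : Fin (N * 2) → GroundTerm (binSig n), I.IsSolution φ ∧
        ((∃ j : Fin N, t = binSig.node f (φ ⟨j * 2 + 0, hlt j⟩) (φ ⟨1, by omega⟩)) ∨
          t = binSig.node f (φ ⟨1, by omega⟩)
            (binSig.node f (φ ⟨3, by omega⟩) (φ ⟨3, by omega⟩))) := by
    intro t
    constructor
    · rintro ⟨φ, s, hs, hφ, rfl⟩
      refine ⟨φ, hφ, ?_⟩
      rcases List.mem_append.1 hs with hs | hs
      · obtain ⟨j, rfl⟩ := (List.mem_ofFn' _ _).1 hs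
        exact Or.inl ⟨j, binSig.subst_node φ _ _ _⟩
      · rw [List.mem_singleton.1 hs]
        right
        exact (binSig.subst_node φ _ _ _).trans (congrArg _ (binSig.subst_node φ _ _ _))
    · rintro ⟨φ, hφ, ⟨j, rfl⟩ | rfl⟩
      · exact ⟨φ, _, List.mem_append_left _ ((List.mem_ofFn' _ _).2 ⟨j, rfl⟩), hφ,
          (binSig.subst_node φ f (.var ⟨j * 2 + 0, hlt j⟩) (.var ⟨1, by omega⟩)).symm⟩
      · exact ⟨φ, _, List.mem_append_right _ (List.mem_singleton.2 rfl), hφ,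
          ((binSig.subst_node φ f (.var ⟨1, by omega⟩) _).trans (congrArg _
            (binSig.subst_node φ f (.var ⟨3, by omega⟩) (.var ⟨3, by omega⟩)))).symm⟩
  constructor
  -- A tree `t₀` that no automaton accepts is covered only by the nonlinear term.
  · intro hreg
    by_contra! hcon
    obtain ⟨t₀, ht₀⟩ := hcon
    refine binSig.not_regular_diagonal f (binSig.ofTree t₀) _ (fun s s' => ?_) hreg
    refine (hmem _).trans ⟨?_, ?_⟩
    · rintro ⟨φ, hφ, ⟨j, h⟩ | h⟩
      · refine absurd ((hsol φ).1 hφ j) ?_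
        rw [← (binSig.node_injective h).1, binSig.toTree_ofTree]
        exact ht₀ j
      · have h1 := binSig.node_injective (binSig.node_injective h).2
        rw [h1.1, h1.2]
    · rintro rfl
      refine ⟨Function.update (Function.update (fun _ => binSig.leaf) ⟨1, by omega⟩
        (binSig.ofTree t₀)) ⟨3, by omega⟩ s,
        (hsol _).2 fun j => ?_, Or.inr ?_⟩
      · rw [Function.update_of_ne (by simp; omega), Function.update_of_ne (by simp)]
        exact hc
      · rw [Function.update_self, Function.update_of_ne (by simp), Function.update_self]
  -- If each tree is accepted, the linear terms alone cover all trees with the root `f`.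
  · intro hall
    refine ⟨binSig.dta (0 : Fin 2) (fun g _ _ => if g = f then 1 else 0) {1}, ?_⟩
    ext t
    refine (hmem t).trans (Iff.trans ?_ (binSig.mem_language_dta _ _ _ t).symm)
    constructor
    · rintro ⟨φ, hφ, ⟨j, rfl⟩ | rfl⟩ <;> simp [binSig.toTree_node, BinaryTree.eval]
    · intro h
      rw [← binSig.ofTree_toTree t]
      cases ht : binSig.toTree t with
      | nil => simp [ht, BinaryTree.eval] at h
      | node g l r =>
        obtain rfl : g = f := by
          by_contra hg
          simp [ht, BinaryTree.eval, hg] at h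
        obtain ⟨j, hj⟩ := hall l
        refine ⟨Function.update (Function.update (fun _ => binSig.leaf)
          ⟨j * 2 + 0, hlt j⟩ (binSig.ofTree l)) ⟨1, by omega⟩ (binSig.ofTree r),
          (hsol _).2 fun i => ?_, Or.inl ⟨j, ?_⟩⟩
        · rw [Function.update_of_ne (by simp)]
          by_cases hij : i = j
          · rw [hij, Function.update_self, binSig.toTree_ofTree]
            exact hj
          · rw [Function.update_of_ne (by simp; omega)]
            exact hc
        · rw [Function.update_self, Function.update_of_ne (by simp), Function.update_self]
          rfl

/-! ### Stack machines that perform one stack operation per step -/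

/-- What a stack machine does with the top of the stack that it inspects. -/
inductive StackAct
  | keep
  | pop
  | push
deriving DecidableEq

/-- A deterministic machine with finitely many stacks. In each step it inspects the top of the
stack `stk q` determined by its state `q`, and keeps, pops or pushes. A stack symbol records where
it comes from: `.inl q` has been pushed by the state `q`, and `.inr b` is a bit of the input. -/
structure StackMachine where
  Q : Type
  K : Type
  [finQ : Fintype Q]
  [finK : Fintype K]
  [decQ : DecidableEq Q]
  [decK : DecidableEq K]
  inputStack : K
  start : Q
  reject : Q
  stk : Q → K
  act : Q → StackAct
  next : Q → Option (Q ⊕ Bool) → Q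

namespace StackMachine

attribute [instance] finQ finK decQ decK

variable (M : StackMachine)

/-- A state and the contents of the stacks, the top being the head of the list. -/
abbrev Cfg : Type := M.Q × (M.K → List (M.Q ⊕ Bool))

/-- The new contents of the stacks after a step. -/
def newStacks (q : M.Q) (P : M.K → List (M.Q ⊕ Bool)) : M.K → List (M.Q ⊕ Bool) :=
  match M.act q with
  | .keep => P
  | .pop => Function.update P (M.stk q) (P (M.stk q)).tail
  | .push => Function.update P (M.stk q) (.inl q :: P (M.stk q))

/-- One step of the machine. -/
def step (c : M.Cfg) : M.Cfg :=
  (M.next c.1 (c.2 (M.stk c.1)).head?, M.newStacks c.1 c.2)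

/-- The initial configuration on the input `w`. -/
def init (w : List Bool) : M.Cfg :=
  (M.start, fun k => if k = M.inputStack then w.map .inr else [])

/-- The configuration at time `t`. -/
def cfg (w : List Bool) (t : ℕ) : M.Cfg := M.step^[t] (M.init w)

theorem cfg_succ (w : List Bool) (t : ℕ) : M.cfg w (t + 1) = M.step (M.cfg w t) :=
  Function.iterate_succ_apply' _ _ _

end StackMachine

/-! ### Binary counters, one bit at a time -/

/-- What the `j`-th automaton knows about an `N`-bit counter after it has read some of the bits:
the `j`-th bit, whether all bits read at positions below `j` are ones (zeros), and whether all bits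
read are ones (zeros). -/
structure BitView where
  bit : Bool
  low1 : Bool
  low0 : Bool
  all1 : Bool
  all0 : Bool
deriving Fintype

namespace BitView

/-- The view before any bit has been read. -/
def fresh (b : Bool) : BitView := ⟨b, true, true, true, true⟩

/-- Read the bit `b`, whose position compares to `j` as `cmp` tells. -/
def read (cmp : Ordering) (b : Bool) (v : BitView) : BitView where
  bit := v.bit
  low1 := v.low1 && (cmp != .lt || b)
  low0 := v.low0 && (cmp != .lt || !b)
  all1 := v.all1 && b
  all0 := v.all0 && !b

/-- The `j`-th bit of the successor. -/
def inc (v : BitView) : Bool := v.bit ^^ v.low1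

/-- The `j`-th bit of the predecessor. -/
def dec (v : BitView) : Bool := v.bit ^^ v.low0

open Classical in
/-- The view on the counter `X` after the bits at the positions in `p` have been read. -/
noncomputable def of (N X : ℕ) (p : ℕ → Prop) (j : ℕ) : BitView where
  bit := X.testBit j
  low1 := decide (∀ i < j, p i → X.testBit i = true)
  low0 := decide (∀ i < j, p i → X.testBit i = false)
  all1 := decide (∀ i < N, p i → X.testBit i = true)
  all0 := decide (∀ i < N, p i → X.testBit i = false)

theorem of_false (N X j : ℕ) : of N X (fun _ => False) j = fresh (X.testBit j) := by
  simp [of, fresh]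

/-- Reading the correct bit at the position `i` adds `i` to the positions that have been read. -/
theorem read_of {N X : ℕ} {p : ℕ → Prop} {i j : ℕ} (hi : i < N) :
    (of N X p j).read (compare i j) (X.testBit i) = of N X (fun l => p l ∨ l = i) j := by
  have h1 : ∀ (n : ℕ) (b : Bool), (∀ l < n, (p l ∨ l = i) → X.testBit l = b) ↔
      (∀ l < n, p l → X.testBit l = b) ∧ (i < n → X.testBit i = b) := by
    intro n b
    constructor
    · intro h
      exact ⟨fun l hl hp => h l hl (Or.inl hp), fun hin => h i hin (Or.inr rfl)⟩
    · rintro ⟨h, h'⟩ l hl (hp | rfl)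
      · exact h l hl hp
      · exact h' hl
  unfold of read
  simp only [BitView.mk.injEq, true_and]
  have h2 : (compare i j != .lt) = true ↔ ¬ i < j := by
    rw [bne_iff_ne, ne_eq, compare_lt_iff_lt]
  refine ⟨?_, ?_, ?_, ?_⟩ <;> rw [Bool.eq_iff_iff] <;>
    simp only [Bool.and_eq_true, decide_eq_true_eq, h1, h2, hi, true_imp_iff, Bool.or_eq_true,
      Bool.not_eq_true', ← imp_iff_not_or]

end BitView

theorem Nat.testBit_add_one_eq (X j : ℕ) :
    (X + 1).testBit j = (X.testBit j ^^ decide (∀ i < j, X.testBit i = true)) := by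
  induction j generalizing X with
  | zero =>
    simp only [Nat.testBit_zero, not_lt_zero, false_imp_iff, implies_true, decide_true]
    rcases Nat.mod_two_eq_zero_or_one X with h | h <;> simp [h, Nat.add_mod]
  | succ j ih =>
    rw [Nat.testBit_succ, Nat.testBit_succ]
    have h1 : (∀ i < j + 1, X.testBit i = true) ↔
        X % 2 = 1 ∧ ∀ i < j, (X / 2).testBit i = true := by
      constructor
      · intro h
        exact ⟨by simpa using h 0 (by omega), fun i hi => by
          rw [← Nat.testBit_succ]; exact h (i + 1) (by omega)⟩
      · rintro ⟨h, h'⟩ i hi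
        cases i with
        | zero => simpa using h
        | succ i => rw [Nat.testBit_succ]; exact h' i (by omega)
    rcases Nat.mod_two_eq_zero_or_one X with h | h
    · have h2 : (X + 1) / 2 = X / 2 := by omega
      rw [h2, decide_eq_false (fun h' => by have := (h1.1 h').1; omega), Bool.xor_false]
    · have h2 : (X + 1) / 2 = X / 2 + 1 := by omega
      rw [h2, ih, Bool.eq_iff_iff]
      simp only [bne_iff_ne, ne_eq, h1, h, true_and]

theorem Nat.forall_testBit_add_one_eq_false (X j : ℕ) :
    (∀ i < j, (X + 1).testBit i = false) ↔ ∀ i < j, X.testBit i = true := by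
  induction j with
  | zero => simp
  | succ j ih =>
    have h1 : ∀ P : ℕ → Prop, (∀ i < j + 1, P i) ↔ (∀ i < j, P i) ∧ P j := fun P => by
      constructor
      · exact fun h => ⟨fun i hi => h i (by omega), h j (by omega)⟩
      · rintro ⟨h, h'⟩ i hi
        rcases Nat.lt_succ_iff_lt_or_eq.1 hi with hi | rfl
        · exact h i hi
        · exact h'
    rw [h1, h1 fun i => X.testBit i = true, ih]
    refine and_congr_right fun h => ?_
    rw [Nat.testBit_add_one_eq]
    rw [decide_eq_true h, Bool.xor_true, Bool.not_eq_false']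

namespace BitView

variable {N X : ℕ} {p : ℕ → Prop} {j : ℕ}

theorem inc_of (hp : ∀ i < N, p i) (hj : j < N) : (of N X p j).inc = (X + 1).testBit j := by
  have h1 : (∀ i < j, p i → X.testBit i = true) ↔ ∀ i < j, X.testBit i = true :=
    ⟨fun h i hi => h i hi (hp i (hi.trans hj)), fun h i hi _ => h i hi⟩
  rw [Nat.testBit_add_one_eq]
  simp only [of, inc, h1]

theorem dec_of (hp : ∀ i < N, p i) (hj : j < N) : (of N (X + 1) p j).dec = X.testBit j := by
  have h1 : (∀ i < j, p i → (X + 1).testBit i = false) ↔ ∀ i < j, X.testBit i = true := by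
    rw [← Nat.forall_testBit_add_one_eq_false]
    exact ⟨fun h i hi => h i hi (hp i (hi.trans hj)), fun h i hi _ => h i hi⟩
  simp only [of, dec, h1]
  rw [Nat.testBit_add_one_eq]
  by_cases h : ∀ i < j, X.testBit i = true <;> simp [h]

theorem all1_of (hX : X < 2 ^ N) (hp : ∀ i < N, p i) :
    (of N X p j).all1 = false ↔ X + 1 < 2 ^ N := by
  simp only [of, decide_eq_false_iff_not]
  rw [← not_iff_not, not_not, not_lt]
  constructor
  · intro h
    have : X = 2 ^ N - 1 := by
      refine Nat.eq_of_testBit_eq fun i => ?_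
      rw [Nat.testBit_two_pow_sub_one]
      by_cases hi : i < N
      · simp [hi, h i hi (hp i hi)]
      · simp only [hi, decide_false]
        exact Nat.testBit_lt_two_pow (hX.trans_le (Nat.pow_le_pow_right two_pos (not_lt.1 hi)))
    omega
  · intro h i hi _
    have : X = 2 ^ N - 1 := by omega
    rw [this, Nat.testBit_two_pow_sub_one]
    simpa using hi

theorem all0_of (hX : X < 2 ^ N) (hp : ∀ i < N, p i) :
    (of N X p j).all0 = false ↔ 0 < X := by
  simp only [of, decide_eq_false_iff_not]
  rw [← not_iff_not, not_not, not_lt, Nat.le_zero]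
  constructor
  · intro h
    refine Nat.eq_of_testBit_eq fun i => ?_
    rw [Nat.zero_testBit]
    by_cases hi : i < N
    · exact h i hi (hp i hi)
    · exact Nat.testBit_lt_two_pow (hX.trans_le (Nat.pow_le_pow_right two_pos (not_lt.1 hi)))
  · rintro rfl i _ _
    exact Nat.zero_testBit i

end BitView

/-! ### Proof trees for the run of a stack machine -/

namespace StackMachine

/-- The kinds of claims that proof trees prove. In addition a claim has a time `t` and a depth
`d`. -/
inductive Kind (Q K : Type)
  /-- Nothing; the kind of the constant. -/
  | none
  /-- The input letter at position `d` is `l` (a blank beyond the end of the input). -/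
  | cell (l : Option Bool)
  /-- The state at time `t` is `q`. -/
  | state (q : Q)
  /-- At time `t` the `d`-th symbol from the top of the stack `k` is `c`. -/
  | content (k : K) (c : Option (Q ⊕ Bool))
deriving Fintype

/-- The inference rules. A rule is applied to two proof trees, one or both of which it may
ignore. -/
inductive Rule (K : Type)
  /-- The state at time `0`. -/
  | start
  /-- The stack `k`, not being the input stack, is empty at time `0`. -/
  | empty (k : K)
  /-- Below a blank there is a blank. -/
  | deeper
  /-- An input cell gives a cell of the input stack at time `0`. -/
  | input
  /-- A state and the top of the stack that it inspects give the next state. -/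
  | next
  /-- A state and a stack cell give the same cell, possibly at another depth, after the step. -/
  | shift
  /-- A state that pushes gives the top of its stack after the step. -/
  | new
deriving Fintype

/-- The states, apart from the error state, of the `j`-th automaton: the kind of the claim, whether
the bits at position `j` have been read, whether the `j`-th input cell has been read, and the views
on the time and the depth. -/
structure Local (Q K : Type) where
  kind : Kind Q K
  seen : Bool
  cellSeen : Bool
  time : BitView
  depth : BitView
deriving Fintype

namespace Local

variable {Q K : Type}

/-- The state at the root of a new claim. -/
def mk' (kind : Kind Q K) (t d : Bool) : Local Q K :=
  ⟨kind, false, false, .fresh t, .fresh d⟩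

open Classical in
/-- The state of the `j`-th automaton on a tree that claims `kind` with time `T` and depth `D`,
after the bits at the positions in `p` and the input cells below `m` have been read. -/
noncomputable def of (N : ℕ) (kind : Kind Q K) (p : ℕ → Prop) (m T D j : ℕ) : Local Q K :=
  ⟨kind, decide (p j), decide (j < m), .of N T p j, .of N D p j⟩

theorem of_false (N : ℕ) (kind : Kind Q K) (T D j : ℕ) :
    of N kind (fun _ => False) 0 T D j = mk' kind (T.testBit j) (D.testBit j) := by
  simp [of, mk', BitView.of_false]

end Local

/-- The labels of proof trees: inference rules, and for each index `i < N` the bits of the time and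
of the depth at position `i`, or (`none`) the `i`-th input cell. -/
abbrev Label (K : Type) (N : ℕ) : Type := Rule K ⊕ (Fin N × Option (Bool × Bool))

variable (M : StackMachine)

/-- The local effect of an inference rule; `none` is an error. A state claim and a claim to which
it is applied have to agree on the time. No counter may overflow. -/
def applyRule : Rule M.K → Local M.Q M.K → Local M.Q M.K → Option (Local M.Q M.K)
  | .start, _, _ => some (.mk' (.state M.start) false false)
  | .empty k, _, _ =>
    if k = M.inputStack then none else some (.mk' (.content k none) false false)
  | .deeper, x, _ =>
    match x.kind with
    | .content k none =>
      if x.seen = true ∧ x.depth.all1 = false then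
        some (.mk' (.content k none) x.time.bit x.depth.inc)
      else none
    | _ => none
  | .input, x, _ =>
    match x.kind with
    | .cell l =>
      if x.seen = true then
        some (.mk' (.content M.inputStack (l.map .inr)) x.time.bit x.depth.bit)
      else none
    | _ => none
  | .next, x, y =>
    match x.kind, y.kind with
    | .state q, .content k c =>
      if x.seen = true ∧ y.seen = true ∧ x.time.bit = y.time.bit ∧ x.time.all1 = false ∧
          k = M.stk q ∧ y.depth.bit = false then
        some (.mk' (.state (M.next q c)) x.time.inc false)
      else none
    | _, _ => none
  | .shift, x, y =>
    match x.kind, y.kind with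
    | .state q, .content k c =>
      if x.seen = true ∧ y.seen = true ∧ x.time.bit = y.time.bit ∧ x.time.all1 = false then
        if k = M.stk q then
          match M.act q with
          | .keep => some (.mk' (.content k c) x.time.inc y.depth.bit)
          | .pop =>
            if y.depth.all0 = false then some (.mk' (.content k c) x.time.inc y.depth.dec)
            else none
          | .push =>
            if y.depth.all1 = false then some (.mk' (.content k c) x.time.inc y.depth.inc)
            else none
        else some (.mk' (.content k c) x.time.inc y.depth.bit)
      else none
    | _, _ => none
  | .new, x, _ =>
    match x.kind with
    | .state q =>
      if x.seen = true ∧ x.time.all1 = false ∧ M.act q = .push then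
        some (.mk' (.content (M.stk q) (some (.inl q))) x.time.inc false)
      else none
    | _ => none

/-- The local effect of a symbol with an index that compares to `j` as `cmp` tells, and for which
`l` is the letter of the input. Bits have to be read once for each index, and input cells in their
order. -/
def applyIdx (cmp : Ordering) (l : Option Bool) :
    Option (Bool × Bool) → Local M.Q M.K → Option (Local M.Q M.K)
  | some (bt, bd), x =>
    if cmp = .eq → x.seen = false ∧ x.time.bit = bt ∧ x.depth.bit = bd then
      some { x with
        seen := x.seen || cmp == .eq
        time := x.time.read cmp bt
        depth := x.depth.read cmp bd }
    else none
  | none, x =>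
    if x.seen = true ∧ x.cellSeen = (cmp == .gt) then
      match x.kind with
      | .none | .cell _ =>
        some ⟨.cell l, false, cmp != .lt, .fresh x.time.bit, .fresh x.depth.inc⟩
      | _ => none
    else none

/-- The state on the constant: time `0`, and depth `-1` (all bits are ones). -/
def leafLocal : Local M.Q M.K := .mk' .none false true

/-- The transition function of the `j`-th automaton; the error state `none` is absorbing. -/
def localStep {N : ℕ} (W : Fin N → Option Bool) (j : Fin N) :
    Label M.K N → Option (Local M.Q M.K) → Option (Local M.Q M.K) → Option (Local M.Q M.K)
  | .inl r, a, b => a.bind fun x => b.bind fun y => M.applyRule r x y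
  | .inr (i, s), a, b => a.bind fun x => b.bind fun _ => M.applyIdx (compare i j) (W i) s x

/-- The state of the `j`-th automaton on a tree. -/
def localEval {N : ℕ} (W : Fin N → Option Bool) (j : Fin N) (t : BinaryTree (Label M.K N)) :
    Option (Local M.Q M.K) :=
  t.eval (some M.leafLocal) (M.localStep W j)

theorem localEval_node {N : ℕ} (W : Fin N → Option Bool) (j : Fin N) (a : Label M.K N)
    (l r : BinaryTree (Label M.K N)) : M.localEval W j (.node a l r) =
      M.localStep W j a (M.localEval W j l) (M.localEval W j r) := rfl

/-- The truth of a claim about the run on the input `w`. For input cells, `m` is the number of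
cells that have been read. -/
def Claim (w : List Bool) (N : ℕ) : Kind M.Q M.K → ℕ → ℕ → ℕ → Prop
  | .none, m, T, D => m = 0 ∧ T = 0 ∧ D + 1 = 2 ^ N
  | .cell l, m, T, D => m ≤ N ∧ T = 0 ∧ m = D + 1 ∧ l = w[D]?
  | .state q, m, T, _ => m = 0 ∧ (M.cfg w T).1 = q
  | .content k c, m, T, D => m = 0 ∧ ((M.cfg w T).2 k)[D]? = c

section Rules

variable {M} {N T D D' : ℕ} {p p' : ℕ → Prop} {w : List Bool} {j : ℕ}

theorem leafLocal_eq (hj : j < N) :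
    M.leafLocal = .of N .none (fun _ => False) 0 0 (2 ^ N - 1) j := by
  rw [Local.of_false, Nat.testBit_two_pow_sub_one]
  simp [leafLocal, hj]

theorem applyRule_deeper (hp : ∀ i < N, p i) (hj : j < N) (hD : D + 1 < 2 ^ N) (k : M.K) (m : ℕ)
    (y : Local M.Q M.K) :
    M.applyRule .deeper (.of N (.content k none) p m T D j) y =
      some (.of N (.content k none) (fun _ => False) 0 T (D + 1) j) := by
  rw [Local.of_false, ← BitView.inc_of hp hj]
  have := (BitView.all1_of (j := j) (Nat.lt_of_succ_lt hD) hp).2 hD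
  simp [applyRule, Local.of, hp j hj, this]
  rfl

theorem applyRule_input (hp : ∀ i < N, p i) (hj : j < N) (l : Option Bool) (m : ℕ)
    (y : Local M.Q M.K) :
    M.applyRule .input (.of N (.cell l) p m T D j) y =
      some (.of N (.content M.inputStack (l.map .inr)) (fun _ => False) 0 T D j) := by
  rw [Local.of_false]
  simp [applyRule, Local.of, hp j hj]
  rfl

theorem applyRule_next (hp : ∀ i < N, p i) (hp' : ∀ i < N, p' i) (hj : j < N)
    (hT : T + 1 < 2 ^ N) (q : M.Q) (c : Option (M.Q ⊕ Bool)) (m m' : ℕ) :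
    M.applyRule .next (.of N (.state q) p m T D j) (.of N (.content (M.stk q) c) p' m' T 0 j) =
      some (.of N (.state (M.next q c)) (fun _ => False) 0 (T + 1) 0 j) := by
  rw [Local.of_false, ← BitView.inc_of hp hj, Nat.zero_testBit]
  have h1 := (BitView.all1_of (j := j) (Nat.lt_of_succ_lt hT) hp).2 hT
  have h2 : (BitView.of N T p j).bit = (BitView.of N T p' j).bit := rfl
  have h3 : (BitView.of N 0 p' j).bit = false := Nat.zero_testBit _
  simp [applyRule, Local.of, hp j hj, hp' j hj, h1, h2, h3]

theorem applyRule_new (hp : ∀ i < N, p i) (hj : j < N)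
    (hT : T + 1 < 2 ^ N) (q : M.Q) (hq : M.act q = .push) (m : ℕ) (y : Local M.Q M.K) :
    M.applyRule .new (.of N (.state q) p m T D j) y =
      some (.of N (.content (M.stk q) (some (.inl q))) (fun _ => False) 0 (T + 1) 0 j) := by
  rw [Local.of_false, ← BitView.inc_of hp hj, Nat.zero_testBit]
  have h1 := (BitView.all1_of (j := j) (Nat.lt_of_succ_lt hT) hp).2 hT
  simp [applyRule, Local.of, hp j hj, h1, hq]

theorem applyRule_shift_keep (hp : ∀ i < N, p i) (hp' : ∀ i < N, p' i) (hj : j < N)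
    (hT : T + 1 < 2 ^ N) (q : M.Q) (k : M.K) (c : Option (M.Q ⊕ Bool)) (m m' : ℕ)
    (hq : k ≠ M.stk q ∨ M.act q = .keep) :
    M.applyRule .shift (.of N (.state q) p m T D j) (.of N (.content k c) p' m' T D' j) =
      some (.of N (.content k c) (fun _ => False) 0 (T + 1) D' j) := by
  rw [Local.of_false, ← BitView.inc_of hp hj]
  have h1 := (BitView.all1_of (j := j) (Nat.lt_of_succ_lt hT) hp).2 hT
  have h2 : (BitView.of N T p j).bit = (BitView.of N T p' j).bit := rfl
  by_cases hk : k = M.stk q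
  · simp [applyRule, Local.of, hp j hj, hp' j hj, h1, h2, hk, hq.resolve_left (not_not.2 hk)]
    rfl
  · simp [applyRule, Local.of, hp j hj, hp' j hj, h1, h2, hk]
    rfl

theorem applyRule_shift_pop (hp : ∀ i < N, p i) (hp' : ∀ i < N, p' i) (hj : j < N)
    (hT : T + 1 < 2 ^ N) (hD : D' + 1 < 2 ^ N) (q : M.Q) (c : Option (M.Q ⊕ Bool)) (m m' : ℕ)
    (hq : M.act q = .pop) :
    M.applyRule .shift (.of N (.state q) p m T D j)
      (.of N (.content (M.stk q) c) p' m' T (D' + 1) j) =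
      some (.of N (.content (M.stk q) c) (fun _ => False) 0 (T + 1) D' j) := by
  rw [Local.of_false, ← BitView.inc_of hp hj, ← BitView.dec_of hp' hj]
  have h1 := (BitView.all1_of (j := j) (Nat.lt_of_succ_lt hT) hp).2 hT
  have h2 : (BitView.of N T p j).bit = (BitView.of N T p' j).bit := rfl
  have h3 := (BitView.all0_of (j := j) hD hp').2 (Nat.succ_pos _)
  simp [applyRule, Local.of, hp j hj, hp' j hj, h1, h2, hq, h3]

theorem applyRule_shift_push (hp : ∀ i < N, p i) (hp' : ∀ i < N, p' i) (hj : j < N)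
    (hT : T + 1 < 2 ^ N) (hD : D' + 1 < 2 ^ N) (q : M.Q) (c : Option (M.Q ⊕ Bool)) (m m' : ℕ)
    (hq : M.act q = .push) :
    M.applyRule .shift (.of N (.state q) p m T D j)
      (.of N (.content (M.stk q) c) p' m' T D' j) =
      some (.of N (.content (M.stk q) c) (fun _ => False) 0 (T + 1) (D' + 1) j) := by
  rw [Local.of_false, ← BitView.inc_of hp hj, ← BitView.inc_of hp' hj]
  have h1 := (BitView.all1_of (j := j) (Nat.lt_of_succ_lt hT) hp).2 hT
  have h2 : (BitView.of N T p j).bit = (BitView.of N T p' j).bit := rfl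
  have h3 := (BitView.all1_of (j := j) (Nat.lt_of_succ_lt hD) hp').2 hD
  simp [applyRule, Local.of, hp j hj, hp' j hj, h1, h2, hq, h3]

theorem applyIdx_bits {i : ℕ} (hi : i < N) (hpi : ¬ p i) (l : Option Bool)
    (kind : Kind M.Q M.K) (m : ℕ) :
    M.applyIdx (compare i j) l (some (T.testBit i, D.testBit i)) (.of N kind p m T D j) =
      some (.of N kind (fun a => p a ∨ a = i) m T D j) := by
  rw [applyIdx, if_pos]
  · simp only [Local.of, BitView.read_of hi, Option.some.injEq, Local.mk.injEq, true_and, and_true]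
    rw [Bool.eq_iff_iff]
    simp only [Bool.or_eq_true, decide_eq_true_eq, beq_iff_eq, compare_eq_iff_eq, eq_comm (a := i)]
  · rw [compare_eq_iff_eq]
    rintro rfl
    exact ⟨by simpa [Local.of] using hpi, rfl, rfl⟩

theorem applyIdx_cell {i : ℕ} (hp : ∀ i < N, p i) (hj : j < N) (l : Option Bool)
    (kind : Kind M.Q M.K) (hk : kind = .none ∨ ∃ l, kind = .cell l)
    (hD : (D + 1).testBit j = i.testBit j) :
    M.applyIdx (compare i j) l none (.of N kind p i T D j) =
      some (.of N (.cell l) (fun _ => False) (i + 1) T i j) := by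
  have h1 : (Local.of N kind p i T D j).cellSeen = (compare i j == .gt) := by
    simp only [Local.of]
    rw [Bool.eq_iff_iff]
    simp only [decide_eq_true_eq, beq_iff_eq, compare_gt_iff_gt]
  have h2 : (compare i j != .lt) = decide (j < i + 1) := by
    rw [Bool.eq_iff_iff]
    simp only [bne_iff_ne, ne_eq, compare_lt_iff_lt, decide_eq_true_eq]
    omega
  have h3 : (Local.of N kind p i T D j).seen = true := by simpa [Local.of] using hp j hj
  rw [applyIdx, if_pos ⟨h3, h1⟩]
  have h4 : (Local.of N kind p i T D j).depth.inc = i.testBit j :=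
    (BitView.inc_of hp hj).trans hD
  rw [h4]
  rcases hk with rfl | ⟨l, rfl⟩ <;>
    simp only [Local.of, BitView.of_false, h2, decide_false] <;> rfl

end Rules

theorem newStacks_of_keep {q : M.Q} {k : M.K} (h : k ≠ M.stk q ∨ M.act q = .keep)
    (P : M.K → List (M.Q ⊕ Bool)) : M.newStacks q P k = P k := by
  unfold newStacks
  rcases h with h | h
  · cases M.act q
    · rfl
    · exact Function.update_of_ne h _ _
    · exact Function.update_of_ne h _ _
  · rw [h]

theorem newStacks_of_pop {q : M.Q} (h : M.act q = .pop) (P : M.K → List (M.Q ⊕ Bool)) :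
    M.newStacks q P (M.stk q) = (P (M.stk q)).tail := by
  simp [newStacks, h]

theorem newStacks_of_push {q : M.Q} (h : M.act q = .push) (P : M.K → List (M.Q ⊕ Bool)) :
    M.newStacks q P (M.stk q) = .inl q :: P (M.stk q) := by
  simp [newStacks, h]

theorem eq_of_testBit_eq {N X Y : ℕ} (hX : X < 2 ^ N) (hY : Y < 2 ^ N)
    (h : ∀ j < N, X.testBit j = Y.testBit j) : X = Y := by
  refine Nat.eq_of_testBit_eq fun i => ?_
  by_cases hi : i < N
  · exact h i hi
  · have h1 : 2 ^ N ≤ 2 ^ i := Nat.pow_le_pow_right two_pos (not_lt.1 hi)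
    rw [Nat.testBit_lt_two_pow (hX.trans_le h1), Nat.testBit_lt_two_pow (hY.trans_le h1)]

section Sound

variable {M} {N : ℕ} {w : List Bool} {kx ky : Kind M.Q M.K} {px py : ℕ → Prop}
  {mx Tx Dx my Ty Dy : ℕ}

/-- An inference rule that causes no error in any of the automata leads from true claims to a true
claim. -/
theorem exists_claim_applyRule (hN : 0 < N) (r : Rule M.K) (hTx : Tx < 2 ^ N) (hDx : Dx < 2 ^ N)
    (hx : M.Claim w N kx mx Tx Dx) (hTy : Ty < 2 ^ N) (hDy : Dy < 2 ^ N)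
    (hy : M.Claim w N ky my Ty Dy)
    (h : ∀ j : Fin N, M.applyRule r (.of N kx px mx Tx Dx j) (.of N ky py my Ty Dy j) ≠ none) :
    ∃ kind T D, T < 2 ^ N ∧ D < 2 ^ N ∧ M.Claim w N kind 0 T D ∧ ∀ j : Fin N,
      M.applyRule r (.of N kx px mx Tx Dx j) (.of N ky py my Ty Dy j) =
        some (.of N kind (fun _ => False) 0 T D j) := by
  have h0 : 0 < 2 ^ N := Nat.two_pow_pos N
  have hseen : ∀ {k : Kind M.Q M.K} {p : ℕ → Prop} {m T D j : ℕ},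
      (Local.of N k p m T D j).seen = true → p j := fun h => by
    simpa [Local.of] using h
  cases r with
  | start =>
    refine ⟨.state M.start, 0, 0, h0, h0, ⟨rfl, rfl⟩, fun j => ?_⟩
    rw [Local.of_false, Nat.zero_testBit]
    rfl
  | empty k =>
    by_cases hk : k = M.inputStack
    · exact absurd (if_pos hk) (h ⟨0, hN⟩)
    · refine ⟨.content k none, 0, 0, h0, h0, ⟨rfl, ?_⟩, fun j => ?_⟩
      · simp [cfg, init, hk]
      · rw [Local.of_false, Nat.zero_testBit]
        exact if_neg hk
  | deeper =>
    match kx, h with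
    | .none, h => exact absurd rfl (h ⟨0, hN⟩)
    | .cell _, h => exact absurd rfl (h ⟨0, hN⟩)
    | .state _, h => exact absurd rfl (h ⟨0, hN⟩)
    | .content _ (some _), h => exact absurd rfl (h ⟨0, hN⟩)
    | .content k none, h =>
      have h1 : ∀ j : Fin N, (Local.of N (.content k none) px mx Tx Dx j).seen = true ∧
          (Local.of N (.content k none) px mx Tx Dx j).depth.all1 = false :=
        fun j => by_contra fun hc => h j (if_neg hc)
      have hp : ∀ i < N, px i := fun i hi => hseen (h1 ⟨i, hi⟩).1
      have hD := (BitView.all1_of hDx hp).1 (h1 ⟨0, hN⟩).2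
      refine ⟨.content k none, Tx, Dx + 1, hTx, hD, ⟨rfl, ?_⟩,
        fun j => applyRule_deeper hp j.2 hD k mx _⟩
      have h2 := hx.2
      rw [List.getElem?_eq_none_iff] at h2 ⊢
      omega
  | input =>
    match kx, h with
    | .none, h => exact absurd rfl (h ⟨0, hN⟩)
    | .state _, h => exact absurd rfl (h ⟨0, hN⟩)
    | .content _ _, h => exact absurd rfl (h ⟨0, hN⟩)
    | .cell l, h =>
      have h1 : ∀ j : Fin N,
          (Local.of (Q := M.Q) (K := M.K) N (.cell l) px mx Tx Dx j).seen = true :=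
        fun j => by_contra fun hc => h j (if_neg hc)
      have hp : ∀ i < N, px i := fun i hi => hseen (h1 ⟨i, hi⟩)
      obtain ⟨-, rfl, -, rfl⟩ := hx
      refine ⟨.content _ _, 0, Dx, hTx, hDx, ⟨rfl, ?_⟩, fun j => applyRule_input hp j.2 _ mx _⟩
      simp [cfg, init]
  | next =>
    match kx, ky, h with
    | .none, _, h => exact absurd rfl (h ⟨0, hN⟩)
    | .cell _, _, h => exact absurd rfl (h ⟨0, hN⟩)
    | .content _ _, _, h => exact absurd rfl (h ⟨0, hN⟩)
    | .state _, .none, h => exact absurd rfl (h ⟨0, hN⟩)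
    | .state _, .cell _, h => exact absurd rfl (h ⟨0, hN⟩)
    | .state _, .state _, h => exact absurd rfl (h ⟨0, hN⟩)
    | .state q, .content k c, h =>
      have h1 : ∀ j : Fin N, (Local.of N (.state q : Kind M.Q M.K) px mx Tx Dx j).seen = true ∧
          (Local.of N (.content k c) py my Ty Dy j).seen = true ∧
          Tx.testBit j = Ty.testBit j ∧ (BitView.of N Tx px j).all1 = false ∧ k = M.stk q ∧
          Dy.testBit j = false :=
        fun j => by_contra fun hc => h j (if_neg hc)
      have hp : ∀ i < N, px i := fun i hi => hseen (h1 ⟨i, hi⟩).1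
      have hp' : ∀ i < N, py i := fun i hi => hseen (h1 ⟨i, hi⟩).2.1
      have hT := (BitView.all1_of hTx hp).1 (h1 ⟨0, hN⟩).2.2.2.1
      obtain rfl : k = M.stk q := (h1 ⟨0, hN⟩).2.2.2.2.1
      obtain rfl : Tx = Ty := eq_of_testBit_eq hTx hTy fun i hi => (h1 ⟨i, hi⟩).2.2.1
      obtain rfl : Dy = 0 := eq_of_testBit_eq hDy h0 fun i hi => by
        rw [Nat.zero_testBit]
        exact (h1 ⟨i, hi⟩).2.2.2.2.2
      refine ⟨.state _, Tx + 1, 0, hT, h0, ⟨rfl, ?_⟩,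
        fun j => applyRule_next hp hp' j.2 hT q c mx my⟩
      rw [cfg_succ, step, hx.2, List.head?_eq_getElem?, hy.2]
  | shift =>
    match kx, ky, h with
    | .none, _, h => exact absurd rfl (h ⟨0, hN⟩)
    | .cell _, _, h => exact absurd rfl (h ⟨0, hN⟩)
    | .content _ _, _, h => exact absurd rfl (h ⟨0, hN⟩)
    | .state _, .none, h => exact absurd rfl (h ⟨0, hN⟩)
    | .state _, .cell _, h => exact absurd rfl (h ⟨0, hN⟩)
    | .state _, .state _, h => exact absurd rfl (h ⟨0, hN⟩)
    | .state q, .content k c, h =>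
      have h1 : ∀ j : Fin N, (Local.of N (.state q : Kind M.Q M.K) px mx Tx Dx j).seen = true ∧
          (Local.of N (.content k c) py my Ty Dy j).seen = true ∧
          Tx.testBit j = Ty.testBit j ∧ (BitView.of N Tx px j).all1 = false :=
        fun j => by_contra fun hc => h j (if_neg hc)
      have hp : ∀ i < N, px i := fun i hi => hseen (h1 ⟨i, hi⟩).1
      have hp' : ∀ i < N, py i := fun i hi => hseen (h1 ⟨i, hi⟩).2.1
      have hT := (BitView.all1_of hTx hp).1 (h1 ⟨0, hN⟩).2.2.2
      obtain rfl : Tx = Ty := eq_of_testBit_eq hTx hTy fun i hi => (h1 ⟨i, hi⟩).2.2.1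
      have h3 : (M.cfg w (Tx + 1)).2 = M.newStacks q (M.cfg w Tx).2 := by
        rw [cfg_succ, step, hx.2]
      by_cases hk : k = M.stk q
      · subst hk
        cases hq : M.act q with
        | keep =>
          refine ⟨.content _ _, Tx + 1, Dy, hT, hDy, ⟨rfl, ?_⟩,
            fun j => applyRule_shift_keep hp hp' j.2 hT q _ c mx my (Or.inr hq)⟩
          rw [h3, M.newStacks_of_keep (Or.inr hq), hy.2]
        | pop =>
          have h4 : (BitView.of N Dy py 0).all0 = false := by
            by_contra hc
            apply h ⟨0, hN⟩
            rw [Bool.not_eq_false] at hc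
            simp only [applyRule, Local.of, hq, hc, if_true, Bool.true_eq_false, if_false, ite_self]
          obtain ⟨D, rfl⟩ := Nat.exists_eq_succ_of_ne_zero
            ((BitView.all0_of hDy hp').1 h4).ne'
          refine ⟨.content _ _, Tx + 1, D, hT, Nat.lt_of_succ_lt hDy, ⟨rfl, ?_⟩,
            fun j => applyRule_shift_pop hp hp' j.2 hT hDy q c mx my hq⟩
          rw [h3, M.newStacks_of_pop hq, List.getElem?_tail, hy.2]
        | push =>
          have h4 : (BitView.of N Dy py 0).all1 = false := by
            by_contra hc
            apply h ⟨0, hN⟩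
            rw [Bool.not_eq_false] at hc
            simp only [applyRule, Local.of, hq, hc, if_true, Bool.true_eq_false, if_false, ite_self]
          have hD := (BitView.all1_of hDy hp').1 h4
          refine ⟨.content _ _, Tx + 1, Dy + 1, hT, hD, ⟨rfl, ?_⟩,
            fun j => applyRule_shift_push hp hp' j.2 hT hD q c mx my hq⟩
          rw [h3, M.newStacks_of_push hq, List.getElem?_cons_succ, hy.2]
      · refine ⟨.content _ _, Tx + 1, Dy, hT, hDy, ⟨rfl, ?_⟩,
          fun j => applyRule_shift_keep hp hp' j.2 hT q k c mx my (Or.inl hk)⟩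
        rw [h3, M.newStacks_of_keep (Or.inl hk), hy.2]
  | new =>
    match kx, h with
    | .none, h => exact absurd rfl (h ⟨0, hN⟩)
    | .cell _, h => exact absurd rfl (h ⟨0, hN⟩)
    | .content _ _, h => exact absurd rfl (h ⟨0, hN⟩)
    | .state q, h =>
      have h1 : ∀ j : Fin N, (Local.of N (.state q : Kind M.Q M.K) px mx Tx Dx j).seen = true ∧
          (BitView.of N Tx px j).all1 = false ∧ M.act q = .push :=
        fun j => by_contra fun hc => h j (if_neg hc)
      have hp : ∀ i < N, px i := fun i hi => hseen (h1 ⟨i, hi⟩).1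
      have hT := (BitView.all1_of hTx hp).1 (h1 ⟨0, hN⟩).2.1
      have hq := (h1 ⟨0, hN⟩).2.2
      refine ⟨.content _ _, Tx + 1, 0, hT, h0, ⟨rfl, ?_⟩,
        fun j => applyRule_new hp j.2 hT q hq mx _⟩
      rw [cfg_succ, step, hx.2]
      exact congrArg (·[0]?) (M.newStacks_of_push hq _)

/-- A symbol with an index that causes no error in any of the automata leads from a true claim to
a true claim. -/
theorem exists_claim_applyIdx (i : Fin N) (s : Option (Bool × Bool)) (hTx : Tx < 2 ^ N)
    (hDx : Dx < 2 ^ N) (hx : M.Claim w N kx mx Tx Dx)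
    (h : ∀ j : Fin N, M.applyIdx (compare i j) w[(i : ℕ)]? s (.of N kx px mx Tx Dx j) ≠ none) :
    ∃ kind p m T D, T < 2 ^ N ∧ D < 2 ^ N ∧ M.Claim w N kind m T D ∧ ∀ j : Fin N,
      M.applyIdx (compare i j) w[(i : ℕ)]? s (.of N kx px mx Tx Dx j) =
        some (.of N kind p m T D j) := by
  have hcmp : ∀ j : Fin N, compare i j = compare (i : ℕ) j := fun j => rfl
  simp only [hcmp] at h ⊢
  cases s with
  | some b =>
    obtain ⟨bt, bd⟩ := b
    have h1 : compare (i : ℕ) i = .eq → (Local.of N kx px mx Tx Dx i).seen = false ∧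
        Tx.testBit i = bt ∧ Dx.testBit i = bd := by_contra fun hc => h i (if_neg hc)
    obtain ⟨h1, rfl, rfl⟩ := h1 (compare_eq_iff_eq.2 rfl)
    exact ⟨kx, _, mx, Tx, Dx, hTx, hDx, hx,
      fun j => applyIdx_bits i.2 (by simpa [Local.of] using h1) _ kx mx⟩
  | none =>
    have h1 : ∀ j : Fin N, (Local.of N kx px mx Tx Dx j).seen = true ∧
        decide ((j : ℕ) < mx) = (compare (i : ℕ) j == .gt) := fun j =>
      by_contra fun hc => h j (if_neg (by simpa [Local.of] using hc))
    have hp : ∀ i < N, px i := fun i hi => by simpa [Local.of] using (h1 ⟨i, hi⟩).1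
    have h2 : ∀ j : Fin N, (j : ℕ) < mx ↔ (j : ℕ) < i := fun j => by
      refine (decide_eq_true_iff (p := (j : ℕ) < mx)).symm.trans ?_
      rw [(h1 j).2, beq_iff_eq, compare_gt_iff_gt]
    have hm : mx ≤ i := not_lt.1 fun h => lt_irrefl _ ((h2 i).1 h)
    obtain rfl : mx = i := hm.antisymm (not_lt.1 fun h => lt_irrefl _
      ((h2 ⟨mx, h.trans i.2⟩).2 h))
    have hi := i.2
    have key : (kx = .none ∨ ∃ l, kx = .cell l) →
        (Tx = 0 ∧ ∀ j < N, (Dx + 1).testBit j = (i : ℕ).testBit j) →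
        ∃ kind p m T D, T < 2 ^ N ∧ D < 2 ^ N ∧ M.Claim w N kind m T D ∧ ∀ j : Fin N,
          M.applyIdx (compare (i : ℕ) j) w[(i : ℕ)]? none (.of N kx px i Tx Dx j) =
            some (.of N kind p m T D j) := by
      rintro hk ⟨rfl, hD⟩
      exact ⟨.cell w[(i : ℕ)]?, _, i + 1, 0, i, hTx, hi.trans Nat.lt_two_pow_self,
        ⟨hi, rfl, rfl, rfl⟩, fun j => applyIdx_cell hp j.2 _ kx hk (hD j j.2)⟩
    match kx, hx, h with
    | .state _, _, h =>
      refine absurd ?_ (h i)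
      rw [applyIdx]
      exact ite_self _
    | .content _ _, _, h =>
      refine absurd ?_ (h i)
      rw [applyIdx]
      exact ite_self _
    | .none, hx, h =>
      refine key (Or.inl rfl) ⟨hx.2.1, fun j hj => ?_⟩
      rw [hx.2.2, hx.1, Nat.zero_testBit, Nat.testBit_two_pow_of_ne hj.ne']
    | .cell l, hx, h =>
      refine key (Or.inr ⟨l, rfl⟩) ⟨hx.2.1, fun j hj => ?_⟩
      rw [hx.2.2.1]

/-- A tree on which no automaton finds an error proves a true claim. -/
theorem exists_claim (hN : 0 < N) {W : Fin N → Option Bool} (hW : ∀ i : Fin N, W i = w[(i : ℕ)]?)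
    (t : BinaryTree (Label M.K N)) (h : ∀ j, M.localEval W j t ≠ none) :
    ∃ kind p m T D, T < 2 ^ N ∧ D < 2 ^ N ∧ M.Claim w N kind m T D ∧
      ∀ j : Fin N, M.localEval W j t = some (.of N kind p m T D j) := by
  induction t with
  | nil =>
    have h0 : 0 < 2 ^ N := Nat.two_pow_pos N
    refine ⟨.none, fun _ => False, 0, 0, 2 ^ N - 1, h0, by omega, ⟨rfl, rfl, by omega⟩,
      fun j => ?_⟩
    rw [← leafLocal_eq j.2]
    rfl
  | node a l r ihl ihr =>
    have hl : ∀ j, M.localEval W j l ≠ none := by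
      intro j hj
      apply h j
      unfold localEval at hj ⊢
      rw [BinaryTree.eval, hj]
      cases a <;> rfl
    have hr : ∀ j, M.localEval W j r ≠ none := by
      intro j hj
      apply h j
      unfold localEval at hj ⊢
      rw [BinaryTree.eval, hj]
      cases a <;> exact Option.bind_fun_none _
    obtain ⟨kx, px, mx, Tx, Dx, hTx, hDx, hx, hxe⟩ := ihl hl
    obtain ⟨ky, py, my, Ty, Dy, hTy, hDy, hy, hye⟩ := ihr hr
    have he : ∀ j, M.localEval W j (.node a l r) =
        M.localStep W j a (some (.of N kx px mx Tx Dx j)) (some (.of N ky py my Ty Dy j)) := by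
      intro j
      rw [← hxe, ← hye, localEval_node]
    cases a with
    | inl a =>
      obtain ⟨k, T, D, hT, hD, hk, hke⟩ := exists_claim_applyRule hN a hTx hDx hx hTy hDy hy
        (fun j => (he j).symm.trans_ne (h j))
      exact ⟨k, _, 0, T, D, hT, hD, hk, fun j => (he j).trans (hke j)⟩
    | inr a =>
      obtain ⟨i, s⟩ := a
      have he : ∀ j, M.localEval W j (.node (.inr (i, s)) l r) =
          M.applyIdx (compare i j) w[(i : ℕ)]? s (.of N kx px mx Tx Dx j) := by
        intro j
        rw [he j, ← hW]
        rfl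
      obtain ⟨k, p, m, T, D, hT, hD, hk, hke⟩ := exists_claim_applyIdx i s hTx hDx hx
        (fun j => (he j).symm.trans_ne (h j))
      exact ⟨k, p, m, T, D, hT, hD, hk, fun j => (he j).trans (hke j)⟩

end Sound

section Complete

variable {M} {N : ℕ} {w : List Bool} {W : Fin N → Option Bool}

/-- A claim has a proof tree in which no automaton finds an error. -/
def Provable (W : Fin N → Option Bool) (kind : Kind M.Q M.K) (m T D : ℕ) : Prop :=
  ∃ t, ∀ j : Fin N, M.localEval W j t = some (.of N kind (fun _ => False) m T D j)

theorem Provable.read_bits {kind : Kind M.Q M.K} {m T D : ℕ} (h : Provable W kind m T D) {n : ℕ}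
    (hn : n ≤ N) : ∃ t, ∀ j : Fin N, M.localEval W j t = some (.of N kind (· < n) m T D j) := by
  induction n with
  | zero =>
    simp only [not_lt_zero]
    exact h
  | succ n ih =>
    obtain ⟨t, ht⟩ := ih (Nat.le_of_succ_le hn)
    refine ⟨.node (.inr (⟨n, hn⟩, some (T.testBit n, D.testBit n))) t .nil, fun j => ?_⟩
    have h1 := applyIdx_bits (M := M) (j := j) (T := T) (D := D) (p := (· < n)) hn
      (lt_irrefl n) (W ⟨n, hn⟩) kind m
    have h2 : (fun a => a < n ∨ a = n) = (· < n + 1) :=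
      funext fun a => propext Nat.lt_succ_iff_lt_or_eq.symm
    rw [h2] at h1
    rw [← h1]
    rw [localEval_node, ht]
    rfl

/-- Provable claims are closed under inference. -/
theorem provable_of_applyRule (r : Rule M.K) {kx ky kind : Kind M.Q M.K}
    {mx Tx Dx my Ty Dy T D : ℕ} (hx : Provable W kx mx Tx Dx) (hy : Provable W ky my Ty Dy)
    (h : ∀ j < N, M.applyRule r (.of N kx (· < N) mx Tx Dx j) (.of N ky (· < N) my Ty Dy j) =
      some (.of N kind (fun _ => False) 0 T D j)) : Provable W kind 0 T D := by
  obtain ⟨x, hx⟩ := hx.read_bits le_rfl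
  obtain ⟨y, hy⟩ := hy.read_bits le_rfl
  refine ⟨.node (.inl r) x y, fun j => ?_⟩
  rw [← h j j.2]
  rw [localEval_node, hx, hy]
  rfl

theorem provable_leaf : Provable (M := M) W .none 0 0 (2 ^ N - 1) :=
  ⟨.nil, fun j => by rw [← leafLocal_eq j.2]; rfl⟩

theorem provable_cell (hW : ∀ i : Fin N, W i = w[(i : ℕ)]?) {i : ℕ} (hi : i < N) :
    Provable (M := M) W (.cell w[i]?) (i + 1) 0 i := by
  have key : ∀ {i : ℕ}, i < N → ∀ {kind : Kind M.Q M.K} {D}, Provable W kind i 0 D →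
      (kind = .none ∨ ∃ l, kind = .cell l) → (∀ j < N, (D + 1).testBit j = i.testBit j) →
      Provable (M := M) W (.cell w[i]?) (i + 1) 0 i := by
    intro i hi kind D h hk hD
    obtain ⟨t, ht⟩ := h.read_bits le_rfl
    refine ⟨.node (.inr (⟨i, hi⟩, none)) t .nil, fun j => ?_⟩
    rw [← applyIdx_cell (p := (· < N)) (fun _ h => h) j.2 w[i]? kind hk (hD j j.2)]
    rw [localEval_node, ht, ← hW ⟨i, hi⟩]
    rfl
  induction i with
  | zero =>
    refine key hi provable_leaf (Or.inl rfl) fun j hj => ?_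
    rw [Nat.sub_add_cancel (Nat.two_pow_pos N), Nat.zero_testBit, Nat.testBit_two_pow_of_ne hj.ne']
  | succ i ih =>
    exact key hi (ih (Nat.lt_of_succ_lt hi)) (Or.inr ⟨_, rfl⟩) fun _ _ => rfl

theorem provable_start : Provable W (.state M.start) 0 0 0 :=
  provable_of_applyRule .start provable_leaf provable_leaf fun j _ => by
    rw [Local.of_false, Nat.zero_testBit]
    rfl

theorem provable_content_zero (hW : ∀ i : Fin N, W i = w[(i : ℕ)]?) (hN : w.length < N) (k : M.K)
    {D : ℕ} (hD : D < 2 ^ N) : Provable W (.content k ((M.cfg w 0).2 k)[D]?) 0 0 D := by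
  have hdeep : ∀ {D}, D + 1 < 2 ^ N → Provable W (.content k none) 0 0 D →
      Provable W (.content k none) 0 0 (D + 1) := fun hD h =>
    provable_of_applyRule .deeper h h fun j hj => applyRule_deeper (fun _ h => h) hj hD k 0 _
  by_cases hk : k = M.inputStack
  · subst hk
    have h1 : ∀ D : ℕ, ((M.cfg w 0).2 M.inputStack)[D]? = w[D]?.map .inr := fun D => by
      simp [cfg, init]
    induction D with
    | zero =>
      rw [h1]
      have h := provable_cell (M := M) hW (Nat.zero_lt_of_lt hN)
      exact provable_of_applyRule .input h h fun j hj => applyRule_input (fun _ h => h) hj _ _ _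
    | succ D ih =>
      by_cases hDN : D + 1 < N
      · rw [h1]
        have h := provable_cell (M := M) hW hDN
        exact provable_of_applyRule .input h h fun j hj =>
          applyRule_input (fun _ h => h) hj _ _ _
      · have ih := ih (Nat.lt_of_succ_lt hD)
        rw [h1, List.getElem?_eq_none_iff.2 (by omega)] at ih ⊢
        exact hdeep hD ih
  · have h1 : ∀ D : ℕ, ((M.cfg w 0).2 k)[D]? = none := fun D => by simp [cfg, init, hk]
    rw [h1]
    induction D with
    | zero =>
      refine provable_of_applyRule (.empty k) provable_leaf provable_leaf fun j _ => ?_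
      rw [Local.of_false, Nat.zero_testBit]
      exact if_neg hk
    | succ D ih => exact hdeep hD (ih (Nat.lt_of_succ_lt hD))

/-- All true state and content claims are provable as long as the counters do not overflow. -/
theorem provable_cfg (hW : ∀ i : Fin N, W i = w[(i : ℕ)]?) (hN : w.length < N) (T : ℕ)
    (hT : T < 2 ^ N) : Provable W (.state (M.cfg w T).1) 0 T 0 ∧
      ∀ k D, T + D < 2 ^ N → Provable W (.content k ((M.cfg w T).2 k)[D]?) 0 T D := by
  induction T with
  | zero =>
    exact ⟨provable_start, fun k D hD => provable_content_zero hW hN k (by omega)⟩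
  | succ T ih =>
    obtain ⟨hs, hc⟩ := ih (Nat.lt_of_succ_lt hT)
    set q := (M.cfg w T).1 with hq
    have hst : (M.cfg w (T + 1)).2 = M.newStacks q (M.cfg w T).2 := by rw [cfg_succ]; rfl
    refine ⟨?_, fun k D hD => ?_⟩
    · refine provable_of_applyRule .next hs (hc (M.stk q) 0 (by omega)) fun j hj => ?_
      rw [applyRule_next (fun _ h => h) (fun _ h => h) hj hT, cfg_succ, step,
        List.head?_eq_getElem?]
    · rw [hst]
      by_cases hk : k ≠ M.stk q ∨ M.act q = .keep
      · rw [M.newStacks_of_keep hk]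
        exact provable_of_applyRule .shift hs (hc k D (by omega)) fun j hj =>
          applyRule_shift_keep (fun _ h => h) (fun _ h => h) hj hT q k _ 0 0 hk
      · push Not at hk
        obtain ⟨rfl, hk⟩ := hk
        cases hact : M.act q with
        | keep => exact absurd hact hk
        | pop =>
          rw [M.newStacks_of_pop hact, List.getElem?_tail]
          exact provable_of_applyRule .shift hs (hc _ (D + 1) (by omega)) fun j hj =>
            applyRule_shift_pop (fun _ h => h) (fun _ h => h) hj hT (by omega) q _ 0 0 hact
        | push =>
          rw [M.newStacks_of_push hact]
          cases D with
          | zero =>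
            exact provable_of_applyRule .new hs hs fun j hj =>
              applyRule_new (fun _ h => h) hj hT q hact 0 _
          | succ D =>
            rw [List.getElem?_cons_succ]
            exact provable_of_applyRule .shift hs (hc _ D (by omega)) fun j hj =>
              applyRule_shift_push (fun _ h => h) (fun _ h => h) hj hT (by omega) q _ 0 0 hact

end Complete

/-- Each proof tree has an error, or proves something other than rejection, iff the machine does
not reject. -/
theorem forall_tree_iff {N : ℕ} {w : List Bool} {W : Fin N → Option Bool}
    (hW : ∀ i : Fin N, W i = w[(i : ℕ)]?) (hN : w.length < N)
    (hrej : (∃ T, (M.cfg w T).1 = M.reject) → ∃ T < 2 ^ N, (M.cfg w T).1 = M.reject) :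
    (∀ t : BinaryTree (Label M.K N), ∃ j,
      ∀ x, M.localEval W j t = some x → x.kind ≠ .state M.reject) ↔
      ∀ T, (M.cfg w T).1 ≠ M.reject := by
  have hN0 : 0 < N := Nat.zero_lt_of_lt hN
  constructor
  · intro h T hT
    obtain ⟨T, hT, hr⟩ := hrej ⟨T, hT⟩
    obtain ⟨t, ht⟩ := (provable_cfg (M := M) hW hN T hT).1
    obtain ⟨j, hj⟩ := h t
    apply hj _ (ht j)
    rw [← hr]
    rfl
  · intro h t
    by_contra! hcon
    choose x hx hk using hcon
    obtain ⟨kind, p, m, T, D, -, -, hc, he⟩ := M.exists_claim hN0 hW t fun j hj => by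
      simp [hx] at hj
    have h1 := hk ⟨0, hN0⟩
    have h2 := (hx ⟨0, hN0⟩).symm.trans (he ⟨0, hN0⟩)
    rw [Option.some.injEq] at h2
    rw [h2] at h1
    change kind = _ at h1
    subst h1
    exact h T hc.2

end StackMachine

/-! ### From Turing machines to stack machines with one operation per step -/

namespace Turing.TM2

variable {K : Type} {Γ : K → Type} {Λ σ : Type}

/-- The statements that occur in a program. -/
def subStmts (m : Λ → Stmt Γ Λ σ) : Set (Stmt Γ Λ σ) := {s | ∃ l, s ∈ stmts₁ (m l)}

theorem subStmts_finite [Finite Λ] (m : Λ → Stmt Γ Λ σ) : (subStmts m).Finite := by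
  have h : subStmts m = ⋃ l, (stmts₁ (m l) : Set (Stmt Γ Λ σ)) := by
    ext s
    simp [subStmts]
  rw [h]
  exact Set.finite_iUnion fun l => Finset.finite_toSet _

theorem mem_subStmts_of_mem {m : Λ → Stmt Γ Λ σ} {s s' : Stmt Γ Λ σ} (h : s ∈ subStmts m)
    (h' : s' ∈ stmts₁ s) : s' ∈ subStmts m := by
  obtain ⟨l, hl⟩ := h
  exact ⟨l, stmts₁_trans hl h'⟩

/-- The number of atomic statements on a longest path through a statement. -/
def Stmt.depth : Stmt Γ Λ σ → ℕ
  | .push _ _ s => s.depth + 1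
  | .peek _ _ s => s.depth + 1
  | .pop _ _ s => s.depth + 1
  | .load _ s => s.depth + 1
  | .branch _ s s' => max s.depth s'.depth + 1
  | .goto _ => 1
  | .halt => 1

/-- The states of the stack machine that simulates the program `m`: a statement that remains to be
executed, with the internal state, or `.inr none` after halting, or `.inr (some b)` after halting
with the output `b`. -/
abbrev SimState (m : Λ → Stmt Γ Λ σ) : Type := {s // s ∈ subStmts m} × σ ⊕ Option Bool

open Classical in
/-- The state at the statement `s`. -/
noncomputable def SimState.at (m : Λ → Stmt Γ Λ σ) (s : Stmt Γ Λ σ) (v : σ) : SimState m :=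
  if h : s ∈ subStmts m then .inl (⟨s, h⟩, v) else .inr none

theorem SimState.at_of_mem {m : Λ → Stmt Γ Λ σ} {s : Stmt Γ Λ σ} (h : s ∈ subStmts m) (v : σ) :
    SimState.at m s v = .inl (⟨s, h⟩, v) := dif_pos h

variable [DecidableEq K]

/-- The symbol that a statement pushes on the stack `k`, if it is a `push` statement. -/
def Stmt.pushed (k : K) : Stmt Γ Λ σ → σ → Option (Γ k)
  | .push k' f _, v => if h : k' = k then some (h ▸ f v) else none
  | _, _ => none

/-- The symbol of the program that a symbol of the simulating machine stands for. -/
def decodeSymb {m : Λ → Stmt Γ Λ σ} {k₀ : K} (ein : Γ k₀ ≃ Bool) (k : K) :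
    SimState m ⊕ Bool → Option (Γ k)
  | .inl (.inl (s, v)) => s.1.pushed k v
  | .inl (.inr _) => none
  | .inr b => if h : k₀ = k then some (h ▸ ein.symm b) else none

/-- The stack machine that executes the program `m` one atomic statement at a time. After halting
it inspects the output stack `k₁`; it rejects if the output is `[false]`. -/
noncomputable def simMachine [Fintype K] [Finite Λ] [Fintype σ] (m : Λ → Stmt Γ Λ σ) (l₀ : Λ)
    (v₀ : σ) {k₀ k₁ : K} (ein : Γ k₀ ≃ Bool) (eout : Γ k₁ ≃ Bool) : StackMachine where
  Q := SimState m
  K := K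
  finQ := by
    haveI := (subStmts_finite m).fintype
    exact inferInstanceAs (Fintype ({s // s ∈ subStmts m} × σ ⊕ Option Bool))
  decQ := Classical.decEq _
  inputStack := k₀
  start := .at m (m l₀) v₀
  reject := .inr (some false)
  stk
    | .inl (⟨.push k _ _, _⟩, _) => k
    | .inl (⟨.peek k _ _, _⟩, _) => k
    | .inl (⟨.pop k _ _, _⟩, _) => k
    | _ => k₁
  act
    | .inl (⟨.push _ _ _, _⟩, _) => .push
    | .inl (⟨.pop _ _ _, _⟩, _) => .pop
    | _ => .keep
  next
    | .inl (⟨.push _ _ s, _⟩, v), _ => .at m s v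
    | .inl (⟨.peek k f s, _⟩, v), c => .at m s (f v (c.bind (decodeSymb ein k)))
    | .inl (⟨.pop k f s, _⟩, v), c => .at m s (f v (c.bind (decodeSymb ein k)))
    | .inl (⟨.load f s, _⟩, v), _ => .at m s (f v)
    | .inl (⟨.branch f s s', _⟩, v), _ => .at m (cond (f v) s s') v
    | .inl (⟨.goto f, _⟩, v), _ => .at m (m (f v)) v
    | .inl (⟨.halt, _⟩, _), _ => .inr none
    | .inr none, c => .inr (some (((c.bind (decodeSymb ein k₁)).map eout).getD false))
    | .inr (some b), _ => .inr (some b)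

variable {m : Λ → Stmt Γ Λ σ} {k₀ k₁ : K} {ein : Γ k₀ ≃ Bool} {eout : Γ k₁ ≃ Bool}

/-- The stacks of the simulating machine represent the stacks of the program. -/
def Represents (ein : Γ k₀ ≃ Bool) (P : K → List (SimState m ⊕ Bool)) (S : ∀ k, List (Γ k)) :
    Prop :=
  ∀ k, (P k).map (decodeSymb ein k) = (S k).map some

theorem Represents.head {P : K → List (SimState m ⊕ Bool)} {S : ∀ k, List (Γ k)}
    (h : Represents ein P S) (k : K) : (P k).head?.bind (decodeSymb ein k) = (S k).head? := by
  have h := congrArg List.head? (h k)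
  rw [List.head?_map, List.head?_map] at h
  cases h1 : (P k).head? with
  | none => cases h2 : (S k).head? <;> simp_all
  | some c => cases h2 : (S k).head? <;> simp_all

theorem Represents.pop {P : K → List (SimState m ⊕ Bool)} {S : ∀ k, List (Γ k)}
    (h : Represents ein P S) (k : K) :
    Represents ein (Function.update P k (P k).tail) (Function.update S k (S k).tail) := by
  intro k'
  by_cases hk : k' = k
  · subst hk
    simp [h k', List.map_tail]
  · simp [hk, h k']

theorem Represents.push {P : K → List (SimState m ⊕ Bool)} {S : ∀ k, List (Γ k)}
    (h : Represents ein P S) (k : K) (c : SimState m ⊕ Bool) (a : Γ k)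
    (hc : decodeSymb ein k c = some a) :
    Represents ein (Function.update P k (c :: P k)) (Function.update S k (a :: S k)) := by
  intro k'
  by_cases hk : k' = k
  · subst hk
    simp [h k', hc]
  · simp [hk, h k']

/-- A configuration of the simulating machine represents one of the program. -/
def RepresentsCfg (ein : Γ k₀ ≃ Bool) (c : SimState m × (K → List (SimState m ⊕ Bool)))
    (a : Cfg Γ Λ σ) : Prop :=
  c.1 = a.l.elim (.inr none) (fun l => .at m (m l) a.var) ∧ Represents ein c.2 a.stk

section Simulation

variable [Fintype K] [Finite Λ] [Fintype σ] {l₀ : Λ} {v₀ : σ}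

/-- The simulating machine executes a statement, up to the next label, in `s.depth` steps. -/
theorem exists_iterate_stepAux (s : Stmt Γ Λ σ) (hs : s ∈ subStmts m) (v : σ)
    (S : ∀ k, List (Γ k)) (P : K → List (SimState m ⊕ Bool)) (hP : Represents ein P S) :
    ∃ t ≤ s.depth, RepresentsCfg ein
      ((simMachine m l₀ v₀ ein eout).step^[t] (.at m s v, P)) (stepAux s v S) := by
  induction s generalizing v S P with
  | push k f s ih =>
    obtain ⟨t, ht, h⟩ := ih (mem_subStmts_of_mem hs (by simp [stmts₁, stmts₁_self])) v _ _
      (hP.push k (.inl (.at m (.push k f s) v)) (f v)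
        (by rw [SimState.at_of_mem hs]; exact dif_pos rfl))
    refine ⟨t + 1, Nat.succ_le_succ ht, ?_⟩
    rw [Function.iterate_succ_apply]
    rw [SimState.at_of_mem hs] at h ⊢
    exact h
  | peek k f s ih =>
    obtain ⟨t, ht, h⟩ := ih (mem_subStmts_of_mem hs (by simp [stmts₁, stmts₁_self]))
      (f v (S k).head?) _ _ hP
    refine ⟨t + 1, Nat.succ_le_succ ht, ?_⟩
    rw [Function.iterate_succ_apply]
    rw [← hP.head] at h
    rw [SimState.at_of_mem hs, stepAux, ← hP.head]
    exact h
  | pop k f s ih =>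
    obtain ⟨t, ht, h⟩ := ih (mem_subStmts_of_mem hs (by simp [stmts₁, stmts₁_self]))
      (f v (S k).head?) _ _ (hP.pop k)
    refine ⟨t + 1, Nat.succ_le_succ ht, ?_⟩
    rw [Function.iterate_succ_apply]
    rw [← hP.head] at h
    rw [SimState.at_of_mem hs, stepAux, ← hP.head]
    exact h
  | load f s ih =>
    obtain ⟨t, ht, h⟩ := ih (mem_subStmts_of_mem hs (by simp [stmts₁, stmts₁_self])) (f v) _ _ hP
    refine ⟨t + 1, Nat.succ_le_succ ht, ?_⟩
    rw [Function.iterate_succ_apply]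
    rw [SimState.at_of_mem hs]
    exact h
  | branch f s s' ih ih' =>
    rw [stepAux]
    have h1 : ∃ t ≤ max s.depth s'.depth, RepresentsCfg ein
        ((simMachine m l₀ v₀ ein eout).step^[t] (.at m (cond (f v) s s') v, P))
          (cond (f v) (stepAux s v S) (stepAux s' v S)) := by
      cases f v with
      | true =>
        obtain ⟨t, ht, h⟩ := ih (mem_subStmts_of_mem hs (by simp [stmts₁, stmts₁_self])) v _ _ hP
        exact ⟨t, ht.trans (le_max_left _ _), h⟩
      | false =>
        obtain ⟨t, ht, h⟩ := ih' (mem_subStmts_of_mem hs (by simp [stmts₁, stmts₁_self])) v _ _ hP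
        exact ⟨t, ht.trans (le_max_right _ _), h⟩
    obtain ⟨t, ht, h⟩ := h1
    refine ⟨t + 1, Nat.succ_le_succ ht, ?_⟩
    rw [Function.iterate_succ_apply, SimState.at_of_mem hs]
    exact h
  | goto f =>
    refine ⟨1, le_rfl, ?_⟩
    rw [Function.iterate_one, SimState.at_of_mem hs]
    exact ⟨rfl, hP⟩
  | halt =>
    refine ⟨1, le_rfl, ?_⟩
    rw [Function.iterate_one, SimState.at_of_mem hs]
    exact ⟨rfl, hP⟩

/-- The simulating machine executes `n` steps of the program in `n * B` steps. -/
theorem exists_iterate_step {B : ℕ} (hB : ∀ l, (m l).depth ≤ B) (n : ℕ)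
    (c : SimState m × (K → List (SimState m ⊕ Bool))) (a b : Cfg Γ Λ σ)
    (hc : RepresentsCfg ein c a) (h : (flip bind (step m))^[n] (some a) = some b) :
    ∃ t ≤ n * B, RepresentsCfg ein ((simMachine m l₀ v₀ ein eout).step^[t] c) b := by
  induction n generalizing c a with
  | zero =>
    rw [Function.iterate_zero, id, Option.some.injEq] at h
    exact ⟨0, Nat.zero_le _, h ▸ hc⟩
  | succ n ih =>
    rw [Function.iterate_succ_apply] at h
    obtain ⟨_ | l, v, S⟩ := a
    · have h1 : ∀ n, (flip bind (step m))^[n] none = none := fun n =>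
        Function.iterate_fixed rfl n
      exact absurd ((h1 n).symm.trans h) (by simp)
    · obtain ⟨t, ht, h1⟩ := exists_iterate_stepAux (l₀ := l₀) (v₀ := v₀) (eout := eout) (m l)
        ⟨l, stmts₁_self⟩ v S c.2 hc.2
      obtain ⟨t', ht', h2⟩ := ih _ _ h1 h
      refine ⟨t' + t, ?_, ?_⟩
      · have := hB l
        rw [Nat.succ_mul]
        omega
      · obtain ⟨c1, c2⟩ := c
        obtain rfl : c1 = SimState.at m (m l) v := hc.1
        exact (Function.iterate_add_apply (simMachine m l₀ v₀ ein eout).step t' t _).symm ▸ h2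

end Simulation

end Turing.TM2

open Turing in
/-- A language in EXPTIME is the set of words that some stack machine does not reject, where the
rejection takes place in exponential time. -/
theorem exists_stackMachine {L : Language Bool} (hL : InEXPTIME L) :
    ∃ (M : StackMachine) (p : Polynomial ℕ), ∀ w : List Bool,
      (w ∈ L ↔ ∀ T, (M.cfg w T).1 ≠ M.reject) ∧
      ((∃ T, (M.cfg w T).1 = M.reject) →
        ∃ T < 2 ^ p.eval w.length, (M.cfg w T).1 = M.reject) := by
  obtain ⟨χ, hχ, ⟨⟨tm, ein, eout⟩, time, hout⟩, p, hp⟩ := hL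
  have := tm.kFin
  have := tm.ΛFin
  have := tm.σFin
  set M := TM2.simMachine tm.m tm.main tm.initialState ein eout with hM
  obtain ⟨B, hB⟩ : ∃ B, ∀ l, (tm.m l).depth ≤ B := by
    obtain ⟨B, hB⟩ := (Set.finite_range fun l => (tm.m l).depth).bddAbove
    exact ⟨B, fun l => hB ⟨l, rfl⟩⟩
  have key : ∀ w, ∃ t ≤ time w.length * B + 1, ∀ t' ≥ t, (M.cfg w t').1 = .inr (some (χ w)) := by
    intro w
    obtain ⟨⟨n, hn⟩, hnt⟩ := hout w
    have hinit : TM2.RepresentsCfg ein (M.init w)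
        (initList tm (w.map ein.invFun)) := by
      refine ⟨rfl, fun k => ?_⟩
      change List.map _ (if k = tm.k₀ then w.map Sum.inr else []) = List.map some (dite _ _ _)
      by_cases hk : k = tm.k₀
      · subst hk
        simp [TM2.decodeSymb]
      · simp [hk]
    obtain ⟨t, ht, h1, h2⟩ := TM2.exists_iterate_step (l₀ := tm.main) (v₀ := tm.initialState)
      (eout := eout) (ein := ein) hB n (M.init w) _ _ hinit hn
    have h3 : (M.cfg w (t + 1)).1 = .inr (some (χ w)) := by
      rw [StackMachine.cfg_succ]
      change (M.cfg w t).1 = .inr none at h1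
      change M.next (M.cfg w t).1 ((M.cfg w t).2 (M.stk (M.cfg w t).1)).head? = _
      rw [h1]
      have h4 := TM2.Represents.head h2 tm.k₁
      change ((M.cfg w t).2 tm.k₁).head?.bind _ = _ at h4
      change Sum.inr (some (((((M.cfg w t).2 tm.k₁).head?.bind _).map eout).getD false)) = _
      rw [h4]
      simp [haltList, Computability.encodeBool]
    refine ⟨t + 1, ?_, fun t' ht' => ?_⟩
    · exact Nat.succ_le_succ (ht.trans (Nat.mul_le_mul_right B hnt))
    · induction t', ht' using Nat.le_induction with
      | base => exact h3
      | succ t' _ ih =>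
        rw [StackMachine.cfg_succ]
        change M.next (M.cfg w t').1 _ = _
        rw [ih]
        rfl
  refine ⟨M, p + Polynomial.C (B + 1), fun w => ?_⟩
  obtain ⟨t, ht, h⟩ := key w
  have hacc : (∃ T, (M.cfg w T).1 = M.reject) ↔ χ w = false := by
    constructor
    · rintro ⟨T, hT⟩
      have h1 : ∀ T' ≥ T, (M.cfg w T').1 = .inr (some false) := by
        intro T' hT'
        induction T', hT' using Nat.le_induction with
        | base => exact hT
        | succ t' _ ih =>
          rw [StackMachine.cfg_succ]
          change M.next (M.cfg w t').1 _ = _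
          rw [ih]
          rfl
      have h2 := (h1 (max T t) (le_max_left _ _)).symm.trans (h (max T t) (le_max_right _ _))
      exact Option.some.inj (Sum.inr.inj h2.symm)
    · intro hw
      exact ⟨t, (h t le_rfl).trans (by rw [hw]; rfl)⟩
  refine ⟨?_, fun hr => ⟨t, ?_, (h t le_rfl).trans (by rw [hacc.1 hr]; rfl)⟩⟩
  · rw [← not_exists, hacc, ← hχ, Bool.not_eq_false]
  · have h1 : time w.length * B + 1 ≤ 2 ^ p.eval w.length * (B + 1) := by
      have h0 : time w.length ≤ 2 ^ p.eval w.length := hp w.length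
      have := Nat.mul_le_mul_right B h0
      have := Nat.two_pow_pos (p.eval w.length)
      rw [Nat.mul_succ]
      omega
    rw [Polynomial.eval_add, Polynomial.eval_C, pow_add]
    have h2 : 2 ^ p.eval w.length * (B + 1) < 2 ^ p.eval w.length * 2 ^ (B + 1) :=
      Nat.mul_lt_mul_of_pos_left Nat.lt_two_pow_self (Nat.two_pow_pos _)
    omega

/-! ### Structured programs on stacks -/

/-- Structured programs that operate on stacks, the `k`-th one with the alphabet `Γ k`. -/
inductive StackProg {K : Type} (Γ : K → Type) : Type
  /-- Do nothing. -/
  | skip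
  /-- Push a symbol. -/
  | push (k : K) (a : Γ k)
  /-- Remove the top of a stack. -/
  | drop (k : K)
  /-- Sequential composition. -/
  | seq (p q : StackProg Γ)
  /-- As long as the stack is not empty, pop a symbol and run the program that is given for it. -/
  | loop (k : K) (body : Γ k → StackProg Γ)

namespace StackProg

variable {K : Type} {Γ : K → Type} [DecidableEq K]

/-- `p.Exec S n S'` means that `p` leads from the stacks `S` to the stacks `S'`, and that the
compiled program takes `n` steps for it. -/
inductive Exec : StackProg Γ → (∀ k, List (Γ k)) → ℕ → (∀ k, List (Γ k)) → Prop
  | skip (S) : Exec .skip S 0 S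
  | push (k a S) : Exec (.push k a) S 1 (Function.update S k (a :: S k))
  | drop (k S) : Exec (.drop k) S 1 (Function.update S k (S k).tail)
  | seq {p q S S' S'' n n'} (h : Exec p S n S') (h' : Exec q S' n' S'') :
    Exec (.seq p q) S (n + n') S''
  | loop_nil {k S} (body : Γ k → StackProg Γ) (h : S k = []) : Exec (.loop k body) S 1 S
  | loop_cons {k S a l S' S'' n n'} {body : Γ k → StackProg Γ} (h : S k = a :: l)
    (h' : Exec (body a) (Function.update S k l) n S') (h'' : Exec (.loop k body) S' n' S'') :
    Exec (.loop k body) S (1 + n + n') S''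

/-- `p.Runs S n S'` means that `p` leads from `S` to `S'` within `n` steps. -/
def Runs (p : StackProg Γ) (S : ∀ k, List (Γ k)) (n : ℕ) (S' : ∀ k, List (Γ k)) : Prop :=
  ∃ m ≤ n, p.Exec S m S'

theorem Runs.mono {p : StackProg Γ} {S S' : ∀ k, List (Γ k)} {n n' : ℕ} (h : p.Runs S n S')
    (hn : n ≤ n') : p.Runs S n' S' := by
  obtain ⟨m, hm, h⟩ := h
  exact ⟨m, hm.trans hn, h⟩

theorem Runs.seq {p q : StackProg Γ} {S S' S'' : ∀ k, List (Γ k)} {n n' : ℕ}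
    (h : p.Runs S n S') (h' : q.Runs S' n' S'') : (StackProg.seq p q).Runs S (n + n') S'' := by
  obtain ⟨m, hm, h⟩ := h
  obtain ⟨m', hm', h'⟩ := h'
  exact ⟨m + m', Nat.add_le_add hm hm', h.seq h'⟩

theorem runs_skip (S : ∀ k, List (Γ k)) : (skip : StackProg Γ).Runs S 0 S := ⟨0, le_rfl, .skip S⟩

theorem runs_push (k : K) (a : Γ k) {S S' : ∀ k, List (Γ k)}
    (h : Function.update S k (a :: S k) = S') : (push k a).Runs S 1 S' :=
  ⟨1, le_rfl, h ▸ .push k a S⟩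

theorem runs_drop (k : K) {S S' : ∀ k, List (Γ k)}
    (h : Function.update S k (S k).tail = S') : (drop k).Runs S 1 S' :=
  ⟨1, le_rfl, h ▸ .drop k S⟩

/-- A loop over a list `l` on the stack `k`, with the invariant `s p q` after `p` has been
processed, `q` being what remains. -/
theorem runs_loop (k : K) (body : Γ k → StackProg Γ) (l : List (Γ k)) (c : ℕ)
    (s : List (Γ k) → List (Γ k) → ∀ k, List (Γ k)) (hs : ∀ p q, s p q k = q)
    (hbody : ∀ p a q, p ++ a :: q = l →
      (body a).Runs (Function.update (s p (a :: q)) k q) c (s (p ++ [a]) q)) :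
    (loop k body).Runs (s [] l) (l.length * (c + 1) + 1) (s l []) := by
  have key : ∀ q p, p ++ q = l → (loop k body).Runs (s p q) (q.length * (c + 1) + 1) (s l []) := by
    intro q
    induction q with
    | nil =>
      rintro p rfl
      rw [List.append_nil]
      exact ⟨1, by simp, .loop_nil body (hs p [])⟩
    | cons a q ih =>
      intro p hp
      obtain ⟨m, hm, h⟩ := hbody p a q hp
      obtain ⟨m', hm', h'⟩ := ih (p ++ [a]) (by simpa using hp)
      refine ⟨1 + m + m', ?_, .loop_cons (hs p (a :: q)) h h'⟩
      rw [List.length_cons, Nat.succ_mul]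
      omega
  exact key l [] rfl

end StackProg

/-! ### Compilation of structured programs to Turing machines -/

namespace StackProg

variable {K : Type} {Γ : K → Type} {Λ : Type}

/-- The labels of the compiled program. -/
def Lab : StackProg Γ → Type
  | skip => Empty
  | push _ _ => Unit
  | drop _ => Unit
  | seq p q => p.Lab ⊕ q.Lab
  | loop k body => Option (Σ a : Γ k, (body a).Lab)

theorem finite_lab [∀ k, Finite (Γ k)] (p : StackProg Γ) : Finite p.Lab := by
  induction p with
  | skip => exact inferInstanceAs (Finite Empty)
  | push => exact inferInstanceAs (Finite Unit)
  | drop => exact inferInstanceAs (Finite Unit)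
  | seq p q ihp ihq => exact inferInstanceAs (Finite (p.Lab ⊕ q.Lab))
  | loop k body ih => exact inferInstanceAs (Finite (Option (Σ a : Γ k, (body a).Lab)))

/-- The label at which the compiled program starts, if its labels are embedded into `Λ` by `ι` and
it exits to the label `x`. -/
def entry : (p : StackProg Γ) → (p.Lab → Λ) → Λ → Λ
  | skip, _, x => x
  | push _ _, ι, _ => ι ()
  | drop _, ι, _ => ι ()
  | seq p q, ι, x => p.entry (fun l => ι (.inl l)) (q.entry (fun l => ι (.inr l)) x)
  | loop _ _, ι, _ => ι none

variable [DecidableEq K]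

/-- The compiled program. The internal state holds, for each stack, the symbol that has been popped
last by a loop over this stack. -/
def compile : (p : StackProg Γ) → (p.Lab → Λ) → Λ → p.Lab →
    Turing.TM2.Stmt Γ Λ (∀ k, Option (Γ k))
  | skip, _, _ => Empty.elim
  | push k a, _, x => fun _ => .push k (fun _ => a) (.goto fun _ => x)
  | drop k, _, x => fun _ => .pop k (fun v _ => v) (.goto fun _ => x)
  | seq p q, ι, x =>
    Sum.elim (p.compile (fun l => ι (.inl l)) (q.entry (fun l => ι (.inr l)) x))
      (q.compile (fun l => ι (.inr l)) x)
  | loop k body, ι, x =>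
    fun l => Option.elim (α := Σ a : Γ k, (body a).Lab) l
      (.pop k (fun v o => Function.update v k o) (.goto fun v =>
        (v k).elim x fun a => (body a).entry (fun l => ι (some ⟨a, l⟩)) (ι none)))
      fun y => (body y.1).compile (fun l => ι (some ⟨y.1, l⟩)) (ι none) y.2

open Turing.TM2 in
/-- The compiled program does what the structured program does, wherever it is embedded. -/
theorem iterate_step_of_exec {p : StackProg Γ} {S S' : ∀ k, List (Γ k)} {n : ℕ}
    (h : p.Exec S n S') (M : Λ → Stmt Γ Λ (∀ k, Option (Γ k))) (ι : p.Lab → Λ) (x : Λ)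
    (hM : ∀ l, M (ι l) = p.compile ι x l) (v : ∀ k, Option (Γ k)) :
    ∃ v', (flip bind (step M))^[n] (some ⟨some (p.entry ι x), v, S⟩) = some ⟨some x, v', S'⟩ := by
  induction h generalizing x v with
  | skip S => exact ⟨v, rfl⟩
  | push k a S =>
    exact ⟨v, congrArg (fun s => some (stepAux s v S)) (hM ())⟩
  | drop k S =>
    exact ⟨v, congrArg (fun s => some (stepAux s v S)) (hM ())⟩
  | @seq p q S S' S'' n n' h h' ih ih' =>
    obtain ⟨v', hv'⟩ := ih (fun l => ι (.inl l)) (q.entry (fun l => ι (.inr l)) x)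
      (fun l => hM (.inl l)) v
    obtain ⟨v'', hv''⟩ := ih' (fun l => ι (.inr l)) x (fun l => hM (.inr l)) v'
    refine ⟨v'', ?_⟩
    rw [Nat.add_comm, Function.iterate_add_apply, ← hv'', ← hv']
    rfl
  | @loop_nil k S body h =>
    refine ⟨Function.update v k none,
      (congrArg (fun s => some (stepAux s v S)) (hM none)).trans ?_⟩
    rw [compile]
    simp [h]
  | @loop_cons k S a l S' S'' n n' body h h' h'' ih ih' =>
    obtain ⟨v', hv'⟩ := ih (fun l => ι (some ⟨a, l⟩)) (ι none) (fun l => hM (some ⟨a, l⟩))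
      (Function.update v k (some a))
    obtain ⟨v'', hv''⟩ := ih' ι x hM v'
    refine ⟨v'', ?_⟩
    have h1 : flip bind (step M) (some ⟨some ((loop k body).entry ι x), v, S⟩) =
        some ⟨some ((body a).entry (fun l => ι (some ⟨a, l⟩)) (ι none)),
          Function.update v k (some a), Function.update S k l⟩ := by
      refine (congrArg (fun s => some (stepAux s v S)) (hM none)).trans ?_
      rw [compile]
      simp [h]
    have h2 : 1 + n + n' = n' + (n + 1) := by omega
    rw [h2, Function.iterate_add_apply, Function.iterate_succ_apply, h1, hv']
    exact hv''

open Turing in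
/-- A function is computable in polynomial time if a structured program computes it in polynomial
time and clears its auxiliary stacks. -/
theorem computableInPolyTime [Fintype K] [∀ k, Fintype (Γ k)] (p : StackProg Γ) {k₀ k₁ : K}
    (ein : Γ k₀ ≃ Bool) (eout : Γ k₁ ≃ Bool) {β : Type} (eb : β → List Bool) (f : List Bool → β)
    (time : Polynomial ℕ)
    (h : ∀ w : List Bool, p.Runs
      (fun k => if h : k = k₀ then h ▸ w.map ein.symm else []) (time.eval w.length)
      (fun k => if h : k = k₁ then h ▸ (eb (f w)).map eout.symm else [])) :
    Nonempty (TM2ComputableInPolyTime (id : List Bool → List Bool) eb f) := by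
  have := p.finite_lab
  have := Fintype.ofFinite p.Lab
  let M : Option p.Lab → TM2.Stmt Γ (Option p.Lab) (∀ k, Option (Γ k))
    | none => .load (fun _ _ => none) .halt
    | some l => p.compile some none l
  let tm : FinTM2 :=
    { k₀ := k₀, k₁ := k₁, Γ := Γ, Λ := Option p.Lab, main := p.entry some none
      σ := ∀ k, Option (Γ k), initialState := fun _ => none, m := M }
  refine ⟨⟨⟨tm, ein, eout⟩, time + 1, fun w => ?_⟩⟩
  have hex : ∃ n ≤ (time + 1).eval w.length, (flip bind tm.step)^[n]
      (some (initList tm (w.map ein.symm))) =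
        some (haltList tm ((eb (f w)).map eout.symm)) := by
    obtain ⟨n, hn, hp⟩ := h w
    obtain ⟨v', hv'⟩ := iterate_step_of_exec hp M some none (fun l => rfl) (fun _ => none)
    refine ⟨n + 1, by simpa using hn, ?_⟩
    rw [Nat.add_comm, Function.iterate_add_apply]
    have h1 : (initList tm (w.map ein.symm)) = ⟨some (p.entry some none), fun _ => none,
        fun k => if h : k = k₀ then h ▸ w.map ein.symm else []⟩ := by
      unfold initList
      congr 1
      funext k
      change dite (k = k₀) _ _ = _
      split_ifs with hk
      · subst k
        rfl
      · rfl
    have h2 : (haltList tm ((eb (f w)).map eout.symm)) = ⟨none, fun _ => none,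
        fun k => if h : k = k₁ then h ▸ (eb (f w)).map eout.symm else []⟩ := by
      unfold haltList
      congr 1
      funext k
      change dite (k = k₁) _ _ = _
      split_ifs with hk
      · subst k
        rfl
      · rfl
    rw [h1, h2]
    exact (congrArg _ hv').trans rfl
  exact ⟨⟨hex.choose, hex.choose_spec.2⟩, hex.choose_spec.1⟩

end StackProg

/-! ### Families of automata given by a table, and their codes -/

/-- The concatenation of the lists `f i a`, where `a` is the `i`-th member of `l`. -/
def List.bindIdx {α β : Type} (f : ℕ → α → List β) (l : List α) : List β :=
  l.zipIdx.flatMap fun x => f x.2 x.1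

namespace List

variable {α β : Type} (f : ℕ → α → List β)

theorem bindIdx_concat (l : List α) (a : α) :
    (l ++ [a]).bindIdx f = l.bindIdx f ++ f l.length a := by
  simp [bindIdx, zipIdx_append]

theorem bindIdx_eq_finRange (l : List α) :
    l.bindIdx f = (List.finRange l.length).flatMap fun i : Fin l.length => f i l[i] := by
  have h : l.zipIdx = (List.finRange l.length).map fun i : Fin l.length => (l[i], (i : ℕ)) :=
    List.ext_getElem (by simp) (by simp)
  rw [bindIdx, h, flatMap_map]

theorem flatMap_finRange {n : ℕ} (g : Fin n → List β) :
    (List.finRange n).flatMap g = (List.ofFn g).flatten := by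
  rw [List.flatMap_def, List.ofFn_eq_map]

theorem flatMap_finRange_add {n n' : ℕ} (g : Fin (n + n') → List β) :
    (List.finRange (n + n')).flatMap g = (List.finRange n).flatMap (fun i : Fin n => g (i.castAdd n')) ++
      (List.finRange n').flatMap fun i : Fin n' => g (i.natAdd n) := by
  simp only [flatMap_finRange, List.ofFn_add, List.flatten_append]
  rfl

theorem flatMap_finRange_mul {n n' : ℕ} (g : Fin (n * n') → List β) :
    (List.finRange (n * n')).flatMap g = (List.finRange n).flatMap fun i : Fin n =>
      (List.finRange n').flatMap fun j : Fin n' => g (finProdFinEquiv (i, j)) := by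
  have h : (List.ofFn fun i => (List.ofFn fun j => g (finProdFinEquiv (i, j))).flatten) =
      (List.ofFn fun i => List.ofFn fun j => g (finProdFinEquiv (i, j))).map List.flatten := by
    rw [List.map_ofFn]
    rfl
  simp only [flatMap_finRange]
  rw [h, ← List.flatten_flatten, List.ofFn_mul]
  congr 3
  funext i
  congr 1
  funext j
  congr 1
  ext
  simp [finProdFinEquiv, Nat.mul_comm, Nat.add_comm]

end List

/-- A table that describes, for each word `W` of letters, complete automata numbered by
`j < W.length`, with the same states, over the signature with `numRules + W.length * numIdx` binary
symbols. The symbol `numRules + i * numIdx + s` acts as `idx c a s`, where `c` tells how `i`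
compares to `j`, and `a` is the `i`-th letter of `W`. -/
structure AutTable where
  numStates : ℕ
  numRules : ℕ
  numIdx : ℕ
  numIdx_pos : 0 < numIdx
  leaf : Fin numStates
  rule : Fin numRules → Fin numStates → Fin numStates → Fin numStates
  idx : Ordering → Option Bool → Fin numIdx → Fin numStates → Fin numStates → Fin numStates
  acc : Finset (Fin numStates)

namespace AutTable

variable (T : AutTable)

/-- The transition function of the `j`-th automaton. -/
def trans (W : List (Option Bool)) (j : ℕ) : Fin (T.numRules + W.length * T.numIdx) →
    Fin T.numStates → Fin T.numStates → Fin T.numStates :=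
  Fin.addCases T.rule fun x =>
    T.idx (compare (finProdFinEquiv.symm x).1.1 j) (W.get (finProdFinEquiv.symm x).1)
      (finProdFinEquiv.symm x).2

theorem trans_castAdd (W : List (Option Bool)) (j : ℕ) (r : Fin T.numRules) :
    T.trans W j (Fin.castAdd _ r) = T.rule r := by
  rw [trans, Fin.addCases_left]

theorem trans_natAdd (W : List (Option Bool)) (j : ℕ) (i : Fin W.length) (s : Fin T.numIdx) :
    T.trans W j (Fin.natAdd _ (finProdFinEquiv (i, s))) =
      T.idx (compare (i : ℕ) j) (W.get i) s := by
  rw [trans, Fin.addCases_right, Equiv.symm_apply_apply]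

/-- The instance of RITRC for the automata described by the table. -/
def inst (W : List (Option Bool)) (hW : 2 ≤ W.length) : ConstrainedTerms :=
  coverInst (n := T.numRules + W.length * T.numIdx) (N := W.length)
    (Nat.add_pos_right _ (Nat.mul_pos (by omega) T.numIdx_pos)) hW T.leaf
    (fun j => T.trans W j) T.acc

/-- The code of the transitions that rewrite `g(a, b)` to `δ a b`. -/
def transCode {K : ℕ} (g : ℕ) (δ : Fin K → Fin K → Fin K) : List (List ℕ) :=
  (List.finRange K).flatMap fun a : Fin K => (List.finRange K).map fun b : Fin K =>
    [g + 1, (a : ℕ), (b : ℕ), (δ a b : ℕ)]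

/-- The number of states and the accepting states of the automata. -/
def headBits (F : Finset (Fin T.numStates)) : List Bool :=
  (T.numStates :: catFin fun q => [if q ∈ F then 1 else 0]).flatMap natBits

/-- The transitions for the constant and the rules. -/
def ruleBits : List Bool :=
  ([0, (T.leaf : ℕ)] ++
    (List.finRange T.numRules).flatMap fun r : Fin T.numRules => (transCode r (T.rule r)).flatten).flatMap natBits

/-- The transitions for the symbols with index `0`. -/
def idxBits (c : Ordering) (a : Option Bool) : List (List Bool) :=
  (List.finRange T.numIdx).flatMap fun s : Fin T.numIdx =>
    (transCode (T.numRules + s) (T.idx c a s)).map fun x => x.flatMap natBits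

/-- Codes of transitions, with the number of the symbol increased by `k`. -/
def shiftBits (k : ℕ) (t : List (List Bool)) : List Bool :=
  t.flatMap fun x => List.replicate k true ++ x

/-- The code of the `j`-th automaton, with the accepting states `F`. -/
def dtaBits (W : List (Option Bool)) (F : Finset (Fin T.numStates)) (j : ℕ) : List Bool :=
  T.headBits F ++
  (List.replicate (W.length * (T.numIdx * (T.numStates * T.numStates))) true ++
    (natBits (1 + T.numRules * (T.numStates * T.numStates)) ++
      (T.ruleBits ++
        W.bindIdx fun i a => shiftBits (i * T.numIdx) (T.idxBits (compare i j) a))))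

theorem natBits_add (m n : ℕ) : natBits (m + n) = List.replicate m true ++ natBits n := by
  rw [natBits, natBits, List.replicate_add, List.append_assoc]

theorem transCode_add {K : ℕ} (k g : ℕ) (δ : Fin K → Fin K → Fin K) :
    (transCode (k + g) δ).flatten.flatMap natBits =
      shiftBits k ((transCode g δ).map fun x => x.flatMap natBits) := by
  simp only [transCode, shiftBits, List.flatMap_def, List.map_flatten, List.map_map]
  simp [Function.comp_def, List.flatten_flatten, natBits_add, Nat.add_assoc]

theorem code_dta {n K : ℕ} (c : Fin K) (δ : Fin n → Fin K → Fin K → Fin K)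
    (F : Finset (Fin K)) : (binSig.dta c δ F).code =
      K :: ((catFin fun q => [if q ∈ F then 1 else 0]) ++ (1 + n * (K * K)) :: ([0, (c : ℕ)] ++
        (List.finRange n).flatMap fun g : Fin n => (transCode g (δ g)).flatten)) := by
  have h1 : (binSig.transList c δ).length = 1 + n * (K * K) := by
    simp [binSig.transList, List.length_flatMap, Nat.add_comm]
  have h2 : (binSig.transList c δ).flatMap Transition.code = [0, (c : ℕ)] ++
      (List.finRange n).flatMap fun g : Fin n => (transCode g (δ g)).flatten := by
    have h3 : (binSig.leafTrans c : Transition (binSig n) K).code = [0, (c : ℕ)] := rfl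
    have h4 : ∀ (g : Fin n) a b, (binSig.nodeTrans g a b (δ g a b)).code =
        [(g : ℕ) + 1, (a : ℕ), (b : ℕ), (δ g a b : ℕ)] := fun _ _ _ => rfl
    rw [binSig.transList, List.flatMap_cons, h3, List.flatMap_assoc]
    congr 2
    funext g
    simp only [List.flatMap_assoc, List.flatMap_map, h4, transCode]
    simp [List.flatMap_def, List.flatten_flatten, Function.comp_def]
  change K :: ((catFin fun q : Fin K => [if q ∈ F then 1 else 0]) ++
    codeList Transition.code (binSig.transList c δ)) = _
  rw [codeList, h1, h2]

theorem flatMap_code_dta (W : List (Option Bool)) (F : Finset (Fin T.numStates)) (j : ℕ) :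
    (binSig.dta T.leaf (T.trans W j) F).code.flatMap natBits = T.dtaBits W F j := by
  have h1 : ∀ i : Fin W.length, (((List.finRange T.numIdx).flatMap fun s : Fin T.numIdx =>
      (transCode (Fin.natAdd T.numRules (finProdFinEquiv (i, s)) : ℕ)
        (T.trans W j (Fin.natAdd T.numRules (finProdFinEquiv (i, s))))).flatten).flatMap natBits) =
      shiftBits (i * T.numIdx) (T.idxBits (compare (i : ℕ) j) W[i]) := by
    intro i
    rw [List.flatMap_assoc, shiftBits, idxBits, List.flatMap_assoc]
    congr 1
    funext s
    have h2 : (Fin.natAdd T.numRules (finProdFinEquiv (i, s)) : ℕ) =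
        i * T.numIdx + (T.numRules + s) := by
      simp [finProdFinEquiv, Nat.mul_comm]
      omega
    rw [h2, trans_natAdd, transCode_add, shiftBits]
    rfl
  rw [code_dta, dtaBits, List.bindIdx_eq_finRange, List.flatMap_finRange_add,
    List.flatMap_finRange_mul]
  simp only [List.flatMap_append, List.flatMap_cons, ← h1, headBits, ruleBits, trans_castAdd,
    List.append_assoc, Fin.val_castAdd]
  congr 2
  rw [Nat.add_mul, ← Nat.add_assoc, Nat.add_comm, natBits_add, Nat.mul_assoc, List.append_assoc]
  congr 3
  simp [List.flatMap_assoc]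

/-- The code of the signature and the number of variables, for `N` letters. -/
def sigBits (N : ℕ) : List Bool :=
  List.replicate (N * T.numIdx) true ++
    (natBits (T.numRules + 1) ++ natBits 0 ++ (List.replicate T.numRules (natBits 2)).flatten ++
      ((List.replicate N (List.replicate T.numIdx (natBits 2)).flatten).flatten ++
        (List.replicate (N * 2) true ++ [false])))

/-- The code of the terms, for the word `W`. -/
def termBits (W : List (Option Bool)) : List Bool :=
  List.replicate W.length true ++ ([true, false] ++
    ((W.bindIdx fun i _ => [1, 1, 0].flatMap natBits ++ (List.replicate (i * 2) true ++
      ([false] ++ [0, 1].flatMap natBits))) ++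
        [1, 1, 0, 1, 1, 1, 0, 3, 0, 3].flatMap natBits))

theorem code_binSig (n : ℕ) : (binSig n).code = (n + 1) :: 0 :: List.replicate n 2 := by
  unfold Signature.code
  change (n + 1) :: catFin (n := n + 1) _ = _
  rw [catFin_succ]
  change (n + 1) :: ([0] ++ catFin fun _ : Fin n => [2]) = _
  simp [catFin, List.ofFn_const]

theorem code_node {n v : ℕ} (g : Fin n) (l r : STerm (binSig n) (Fin v)) :
    (binSig.node g l r).code = 1 :: ((g : ℕ) + 1) :: (l.code ++ r.code) := by
  unfold binSig.node
  change 1 :: ((g : ℕ) + 1) :: catFin (fun i : Fin 2 => ((![l, r] : Fin 2 → _) i).code) = _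
  simp [catFin]

theorem code_terms {n N v : ℕ} (g : Fin n) (x : Fin N → Fin v) (y z : Fin v) :
    codeList STerm.code ((List.ofFn fun j => binSig.node g (.var (x j)) (.var y)) ++
      [binSig.node g (.var y) (binSig.node g (.var z) (.var z))]) =
    (N + 1) :: (((List.finRange N).flatMap fun j : Fin N => [1, (g : ℕ) + 1, 0, (x j : ℕ), 0, y]) ++
      [1, (g : ℕ) + 1, 0, y, 1, g + 1, 0, z, 0, z]) := by
  have h : ∀ k, (STerm.var (S := binSig n) (k : Fin v)).code = [0, (k : ℕ)] := fun _ => rfl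
  simp [codeList, List.ofFn_eq_map, List.flatMap_map, code_node, h]

theorem encode_inst (W : List (Option Bool)) (hW : 2 ≤ W.length) :
    (T.inst W hW).encode = T.sigBits W.length ++
      ((W.bindIdx fun j _ => T.dtaBits W T.acc j ++ T.dtaBits W Finset.univ j) ++
        termBits W) := by
  have hsig : (T.inst W hW).sig.code.flatMap natBits ++ natBits (W.length * 2) =
      T.sigBits W.length := by
    change (binSig _).code.flatMap natBits ++ _ = _
    have h : ∀ (n m : ℕ) (l : List Bool), (List.replicate (n * m) l).flatten =
        (List.replicate n (List.replicate m l).flatten).flatten := by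
      intro n m l
      induction n with
      | zero => simp
      | succ n ih => rw [Nat.succ_mul, Nat.add_comm, List.replicate_add, List.flatten_append, ih,
          List.replicate_succ, List.flatten_cons]
    rw [code_binSig, List.flatMap_cons, List.flatMap_cons, List.flatMap_replicate, sigBits, ← h,
      List.replicate_add, List.flatten_append, Nat.add_right_comm, Nat.add_comm _ (_ * T.numIdx),
      natBits_add]
    simp only [List.append_assoc, natBits]
  have hvar : (catFin fun x => ((T.inst W hW).constr x).code).flatMap natBits =
      W.bindIdx fun j _ => T.dtaBits W T.acc j ++ T.dtaBits W Finset.univ j := by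
    rw [catFin, ← List.flatMap_finRange, List.flatMap_assoc, List.bindIdx_eq_finRange]
    refine (List.flatMap_finRange_mul (n := W.length) (n' := 2) _).trans ?_
    congr 1
    funext j
    have h : ∀ b : Fin 2, ((T.inst W hW).constr (finProdFinEquiv (j, b))).code.flatMap natBits =
        T.dtaBits W (if b = 0 then T.acc else Finset.univ) j := by
      intro b
      have h1 : (finProdFinEquiv (j, b) : ℕ) / 2 = j := by
        simp [finProdFinEquiv]
        omega
      have h2 : (finProdFinEquiv (j, b) : ℕ) % 2 = b := by
        simp [finProdFinEquiv]
        omega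
      change (binSig.dta T.leaf (T.trans W ((finProdFinEquiv (j, b) : ℕ) / 2)) (if
        (finProdFinEquiv (j, b) : ℕ) % 2 = 0 then T.acc else Finset.univ)).code.flatMap natBits = _
      rw [flatMap_code_dta, h1, h2]
      simp only [Fin.ext_iff, Fin.val_zero]
    simp only [h]
    simp [List.finRange_succ]
  have hterm : (codeList STerm.code (T.inst W hW).terms).flatMap natBits = termBits W := by
    have h1 : List.replicate W.length true ++ [true, false] = natBits (W.length + 1) := by
      rw [natBits_add]
      rfl
    rw [termBits, ← List.append_assoc, h1, List.bindIdx_eq_finRange]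
    refine (congrArg _ (code_terms (n := T.numRules + W.length * T.numIdx) (v := W.length * 2)
      _ (fun j : Fin W.length => ⟨j * 2 + 0, by omega⟩) _ _)).trans ?_
    simp [List.flatMap_assoc, natBits]
  rw [← hsig, ← hvar, ← hterm]
  simp [ConstrainedTerms.encode, ConstrainedTerms.code]
  rfl

end AutTable

/-! ### A program that writes the code of an instance -/

/-- The stacks of the reduction: the input, the output, the reversed output, and four stacks of
letters. -/
inductive RedStack
  | inp
  | out
  | rev
  | a
  | b
  | d
  | e
deriving DecidableEq

namespace RedStack

instance : Fintype RedStack := ⟨{inp, out, rev, a, b, d, e}, fun k => by cases k <;> decide⟩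

/-- The alphabets of the stacks. -/
abbrev Sym : RedStack → Type
  | inp | out | rev => Bool
  | a | b | d | e => Option Bool

instance : ∀ k, Fintype (Sym k)
  | inp | out | rev => inferInstanceAs (Fintype Bool)
  | a | b | d | e => inferInstanceAs (Fintype (Option Bool))

/-- The stacks with the given contents; `o` is the output that has been written so far on the stack
`rev`, in the order of writing. -/
def st (i u o : List Bool) (la lb ld le : List (Option Bool)) : ∀ k, List (Sym k)
  | inp => i
  | out => u
  | rev => o.reverse
  | a => la
  | b => lb
  | d => ld
  | e => le

variable (i u o : List Bool) (la lb ld le : List (Option Bool))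

@[simp] theorem st_inp : st i u o la lb ld le inp = i := rfl
@[simp] theorem st_out : st i u o la lb ld le out = u := rfl
@[simp] theorem st_rev : st i u o la lb ld le rev = o.reverse := rfl
@[simp] theorem st_a : st i u o la lb ld le a = la := rfl
@[simp] theorem st_b : st i u o la lb ld le b = lb := rfl
@[simp] theorem st_d : st i u o la lb ld le d = ld := rfl
@[simp] theorem st_e : st i u o la lb ld le e = le := rfl

@[simp] theorem update_inp (l : List Bool) :
    Function.update (st i u o la lb ld le) inp l = st l u o la lb ld le := by
  funext k; cases k <;> rfl

@[simp] theorem update_out (l : List Bool) :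
    Function.update (st i u o la lb ld le) out l = st i l o la lb ld le := by
  funext k; cases k <;> rfl

@[simp] theorem update_rev (l : List Bool) :
    Function.update (st i u o la lb ld le) rev l = st i u l.reverse la lb ld le := by
  funext k; cases k <;> simp [Function.update, st]

@[simp] theorem update_a (l : List (Option Bool)) :
    Function.update (st i u o la lb ld le) a l = st i u o l lb ld le := by
  funext k; cases k <;> rfl

@[simp] theorem update_b (l : List (Option Bool)) :
    Function.update (st i u o la lb ld le) b l = st i u o la l ld le := by
  funext k; cases k <;> rfl

@[simp] theorem update_d (l : List (Option Bool)) :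
    Function.update (st i u o la lb ld le) d l = st i u o la lb l le := by
  funext k; cases k <;> rfl

@[simp] theorem update_e (l : List (Option Bool)) :
    Function.update (st i u o la lb ld le) e l = st i u o la lb ld l := by
  funext k; cases k <;> rfl

end RedStack

namespace RedProg

open StackProg RedStack

/-- Write a fixed string. -/
def emit : List Bool → StackProg Sym
  | [] => skip
  | x :: l => seq (push rev x) (emit l)

theorem runs_emit (l : List Bool) (i u o la lb ld le) : (emit l).Runs (st i u o la lb ld le)
    l.length (st i u (o ++ l) la lb ld le) := by
  induction l generalizing o with
  | nil =>
    rw [List.append_nil]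
    exact runs_skip _
  | cons x l ih =>
    have h := (runs_push rev x (S := st i u o la lb ld le) (S' := st i u (o ++ [x]) la lb ld le)
      (by simp)).seq (ih (o ++ [x]))
    rw [List.append_assoc] at h
    exact h.mono (by simp; omega)

/-! The following loops move the letters from one stack to another. -/

theorem runs_move_ba (i u o la l ld le) : (loop b fun x => push a x : StackProg Sym).Runs
    (st i u o la l ld le) (l.length * 2 + 1) (st i u o (l.reverse ++ la) [] ld le) :=
  runs_loop b _ l 1 (fun p q => st i u o (p.reverse ++ la) q ld le) (fun _ _ => rfl)
    fun p x q _ => runs_push _ _ (by simp)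

theorem runs_move_db (i u o la lb l le) : (loop d fun x => push b x : StackProg Sym).Runs
    (st i u o la lb l le) (l.length * 2 + 1) (st i u o la (l.reverse ++ lb) [] le) :=
  runs_loop d _ l 1 (fun p q => st i u o la (p.reverse ++ lb) q le) (fun _ _ => rfl)
    fun p x q _ => runs_push _ _ (by simp)

theorem runs_move_da (i u o la lb l le) : (loop d fun x => push a x : StackProg Sym).Runs
    (st i u o la lb l le) (l.length * 2 + 1) (st i u o (l.reverse ++ la) lb [] le) :=
  runs_loop d _ l 1 (fun p q => st i u o (p.reverse ++ la) lb q le) (fun _ _ => rfl)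
    fun p x q _ => runs_push _ _ (by simp)

theorem runs_move_ed (i u o la lb ld l) : (loop e fun x => push d x : StackProg Sym).Runs
    (st i u o la lb ld l) (l.length * 2 + 1) (st i u o la lb (l.reverse ++ ld) []) :=
  runs_loop e _ l 1 (fun p q => st i u o la lb (p.reverse ++ ld) q) (fun _ _ => rfl)
    fun p x q _ => runs_push _ _ (by simp)

theorem runs_move_ea (i u o la lb ld l) : (loop e fun x => push a x : StackProg Sym).Runs
    (st i u o la lb ld l) (l.length * 2 + 1) (st i u o (l.reverse ++ la) lb ld []) :=
  runs_loop e _ l 1 (fun p q => st i u o (p.reverse ++ la) lb ld q) (fun _ _ => rfl)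
    fun p x q _ => runs_push _ _ (by simp)

theorem replicate_flatten_succ (n : ℕ) (s : List Bool) :
    (List.replicate n s).flatten ++ s = (List.replicate (n + 1) s).flatten := by
  rw [List.replicate_add]
  simp

/-- Write the string `s` once for each letter on the stack `d`. -/
def perD (s : List Bool) : StackProg Sym :=
  seq (loop d fun x => seq (push e x) (emit s)) (loop e fun x => push d x)

theorem runs_perD (s : List Bool) (i u o la lb ld) : (perD s).Runs (st i u o la lb ld [])
    (ld.length * (s.length + 4) + 2)
    (st i u (o ++ (List.replicate ld.length s).flatten) la lb ld []) := by
  have h1 : (loop d fun x => seq (push e x) (emit s) : StackProg Sym).Runs (st i u o la lb ld [])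
      (ld.length * (1 + s.length + 1) + 1)
      (st i u (o ++ (List.replicate ld.length s).flatten) la lb [] (ld.reverse ++ [])) := by
    have h := runs_loop d (fun x => seq (push e x) (emit s)) ld (1 + s.length)
      (fun p q => st i u (o ++ (List.replicate p.length s).flatten) la lb q p.reverse)
      (fun _ _ => rfl) fun p x q _ => ?_
    · simpa using h
    · refine (runs_push (Γ := Sym) e x (by simp; rfl)).seq ?_
      have h := runs_emit s i u (o ++ (List.replicate p.length s).flatten) la lb q (x :: p.reverse)
      rw [List.append_assoc, replicate_flatten_succ] at h
      simpa using h
  rw [List.append_nil] at h1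
  have h2 := runs_move_ed i u (o ++ (List.replicate ld.length s).flatten) la lb [] ld.reverse
  rw [List.reverse_reverse, List.append_nil, List.length_reverse] at h2
  exact (h1.seq h2).mono (le_of_eq (by ring))

/-- Write the string `s` once for each letter on the stack `a`. -/
def perA (s : List Bool) : StackProg Sym :=
  seq (loop a fun x => seq (push e x) (emit s)) (loop e fun x => push a x)

theorem runs_perA (s : List Bool) (i u o la lb ld) : (perA s).Runs (st i u o la lb ld [])
    (la.length * (s.length + 4) + 2)
    (st i u (o ++ (List.replicate la.length s).flatten) la lb ld []) := by
  have h1 : (loop a fun x => seq (push e x) (emit s) : StackProg Sym).Runs (st i u o la lb ld [])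
      (la.length * (1 + s.length + 1) + 1)
      (st i u (o ++ (List.replicate la.length s).flatten) [] lb ld (la.reverse ++ [])) := by
    have h := runs_loop a (fun x => seq (push e x) (emit s)) la (1 + s.length)
      (fun p q => st i u (o ++ (List.replicate p.length s).flatten) q lb ld p.reverse)
      (fun _ _ => rfl) fun p x q _ => ?_
    · simpa using h
    · refine (runs_push (Γ := Sym) e x (by simp; rfl)).seq ?_
      have h := runs_emit s i u (o ++ (List.replicate p.length s).flatten) q lb ld (x :: p.reverse)
      rw [List.append_assoc, replicate_flatten_succ] at h
      simpa using h
  rw [List.append_nil] at h1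
  have h2 := runs_move_ea i u (o ++ (List.replicate la.length s).flatten) [] lb ld la.reverse
  rw [List.reverse_reverse, List.append_nil, List.length_reverse] at h2
  exact (h1.seq h2).mono (le_of_eq (by ring))

theorem replicate_replicate (n m : ℕ) :
    (List.replicate n (List.replicate m true)).flatten = List.replicate (n * m) true := by
  simp

/-- Write the codes `t` of transitions, with the numbers of the symbols increased by `m` for each
letter on the stack `d`. -/
def emitShift (m : ℕ) : List (List Bool) → StackProg Sym
  | [] => skip
  | x :: t => seq (perD (List.replicate m true)) (seq (emit x) (emitShift m t))

theorem runs_emitShift (m : ℕ) (t : List (List Bool)) (i u o la lb ld) :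
    (emitShift m t).Runs (st i u o la lb ld [])
      (t.length * (ld.length * (m + 4) + 2) + t.flatten.length)
      (st i u (o ++ AutTable.shiftBits (ld.length * m) t) la lb ld []) := by
  induction t generalizing o with
  | nil =>
    simp only [AutTable.shiftBits, List.flatMap_nil, List.append_nil]
    exact (runs_skip _).mono (Nat.zero_le _)
  | cons x t ih =>
    have h1 := runs_perD (List.replicate m true) i u o la lb ld
    rw [replicate_replicate, List.length_replicate] at h1
    have h2 := h1.seq ((runs_emit x i u _ la lb ld []).seq (ih _))
    rw [List.append_assoc, List.append_assoc] at h2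
    simp only [AutTable.shiftBits, List.flatMap_cons, List.append_assoc]
    refine h2.mono (le_of_eq ?_)
    rw [List.length_cons, List.flatten_cons, List.length_append]
    ring

variable (T : AutTable)

/-- A bound for the lengths of the lists `idxBits`. -/
def idxBound : ℕ :=
  ∑ a : Option Bool, ∑ c ∈ ({.lt, .eq, .gt} : Finset Ordering),
    ((T.idxBits c a).length + (T.idxBits c a).flatten.length)

theorem le_idxBound (c : Ordering) (a : Option Bool) :
    (T.idxBits c a).length + (T.idxBits c a).flatten.length ≤ idxBound T := by
  refine le_trans ?_ (Finset.single_le_sum (f := fun a => ∑ c ∈ ({.lt, .eq, .gt} : Finset Ordering),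
    ((T.idxBits c a).length + (T.idxBits c a).flatten.length)) (fun _ _ => Nat.zero_le _)
    (Finset.mem_univ a))
  exact Finset.single_le_sum
    (f := fun c => (T.idxBits c a).length + (T.idxBits c a).flatten.length)
    (fun _ _ => Nat.zero_le _) (by cases c <;> decide)

/-- Write the transitions for the symbols whose index is the number of letters on `d`. -/
def emitIdx (c : Ordering) (x : Option Bool) : StackProg Sym :=
  emitShift T.numIdx (T.idxBits c x)

/-- A bound for the running time of `emitIdx`, if there are at most `N` letters. -/
def idxTime (N : ℕ) : ℕ := idxBound T * (N * (T.numIdx + 4) + 2) + idxBound T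

theorem runs_emitIdx (c : Ordering) (x : Option Bool) (N : ℕ) (i u o la lb ld)
    (hN : ld.length ≤ N) : (emitIdx T c x).Runs (st i u o la lb ld []) (idxTime T N)
      (st i u (o ++ AutTable.shiftBits (ld.length * T.numIdx) (T.idxBits c x)) la lb ld []) := by
  refine (runs_emitShift T.numIdx (T.idxBits c x) i u o la lb ld).mono ?_
  have h := le_idxBound T c x
  exact Nat.add_le_add (Nat.mul_le_mul (by omega) (Nat.add_le_add_right
    (Nat.mul_le_mul_right _ hN) 2)) (by omega)

/-- The number of transitions per letter. -/
def rate : ℕ := T.numIdx * (T.numStates * T.numStates)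

/-- The part of the code of an automaton that does not depend on the letters. -/
def constBits : List Bool := natBits (1 + T.numRules * (T.numStates * T.numStates)) ++ T.ruleBits

/-- The transitions for the letter `x` with index `i` in the `j`-th automaton. -/
def idxPart (j i : ℕ) (x : Option Bool) : List Bool :=
  AutTable.shiftBits (i * T.numIdx) (T.idxBits (compare i j) x)

theorem runs_lt_part (p : List (Option Bool)) (N : ℕ) (hN : p.length ≤ N) (i u o q) :
    (loop b fun y => seq (emitIdx T .lt y) (push d y)).Runs (st i u o q p [] [])
      (p.length * (idxTime T N + 1 + 1) + 1)
      (st i u (o ++ p.bindIdx (idxPart T p.length)) q [] p.reverse []) := by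
  have h := runs_loop b (fun y => seq (emitIdx T .lt y) (push d y)) p (idxTime T N + 1)
    (fun r s => st i u (o ++ r.bindIdx (idxPart T p.length)) q s r.reverse []) (fun _ _ => rfl)
    fun r y s hr => ?_
  · simpa [List.bindIdx] using h
  · have hr' : r.length < p.length := by rw [← hr]; simp
    have h := (runs_emitIdx T .lt y N i u (o ++ r.bindIdx (idxPart T p.length)) q s r.reverse
      (by simp; omega)).seq (runs_push (Γ := Sym) d y (update_d ..))
    have hk : idxPart T p.length r.length y = AutTable.shiftBits
        (r.reverse.length * T.numIdx) (T.idxBits .lt y) := by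
      rw [idxPart, Nat.compare_eq_lt.2 hr', List.length_reverse]
    rw [List.bindIdx_concat, hk, update_b, List.reverse_append]
    rw [List.append_assoc] at h
    exact h

theorem runs_gt_part (p q : List (Option Bool)) (x : Option Bool) (N : ℕ)
    (hN : p.length + 1 + q.length ≤ N) (i u o) :
    (loop a fun y => seq (emitIdx T .gt y) (seq (push d y) (push b y))).Runs
      (st i u (o ++ (p ++ [x]).bindIdx (idxPart T p.length)) q [] (p ++ [x]).reverse [])
      (q.length * (idxTime T N + (1 + 1) + 1) + 1)
      (st i u (o ++ (p ++ x :: q).bindIdx (idxPart T p.length)) [] q.reverse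
        (p ++ x :: q).reverse []) := by
  have h := runs_loop a (fun y => seq (emitIdx T .gt y) (seq (push d y) (push b y))) q
    (idxTime T N + (1 + 1))
    (fun r s => st i u (o ++ (p ++ [x] ++ r).bindIdx (idxPart T p.length)) s r.reverse
      (p ++ [x] ++ r).reverse []) (fun _ _ => rfl) fun r y s hr => ?_
  · simpa using h
  · have hr' : r.length < q.length := by rw [← hr]; simp
    have hr'' : p.length < (p ++ [x] ++ r).length := by simp
    have h := (runs_emitIdx T .gt y N i u (o ++ (p ++ [x] ++ r).bindIdx (idxPart T p.length)) s
      r.reverse (p ++ [x] ++ r).reverse (by simp; omega)).seq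
      ((runs_push (Γ := Sym) d y (update_d ..)).seq (runs_push (Γ := Sym) b y (update_b ..)))
    have hk : idxPart T p.length (p ++ [x] ++ r).length y = AutTable.shiftBits
        ((p ++ [x] ++ r).reverse.length * T.numIdx) (T.idxBits .gt y) := by
      rw [idxPart, Nat.compare_eq_gt.2 hr'', List.length_reverse]
    rw [← List.append_assoc (p ++ [x]), List.bindIdx_concat, hk, update_a,
      List.reverse_append (as := r), List.reverse_append (as := p ++ [x] ++ r), ← List.append_assoc o]
    exact h

/-- Write the transitions of an automaton for the letters. The letter at its position is `x`, the
letters before this position are on the stack `d`, and those after it are on `a`. -/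
def letters (x : Option Bool) : StackProg Sym :=
  seq (loop d fun y => push b y) <|
  seq (loop b fun y => seq (emitIdx T .lt y) (push d y)) <|
  seq (seq (emitIdx T .eq x) (push d x)) <|
  seq (loop a fun y => seq (emitIdx T .gt y) (seq (push d y) (push b y))) <|
  seq (loop b fun y => seq (push a y) (drop d)) (drop d)

/-- A bound for the running time of `letters`, if there are `N` letters. -/
def lettersTime (N : ℕ) : ℕ :=
  (N * 2 + 1) + (N * (idxTime T N + 2) + 1) + (idxTime T N + 1) +
    (N * (idxTime T N + 3) + 1) + (N * 3 + 1) + 1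

theorem runs_letters (p q : List (Option Bool)) (x : Option Bool) (i u o) :
    (letters T x).Runs (st i u o q [] p.reverse []) (lettersTime T (p ++ x :: q).length)
      (st i u (o ++ (p ++ x :: q).bindIdx (idxPart T p.length)) q [] p.reverse []) := by
  set N := (p ++ x :: q).length with hN
  have hN' : p.length + 1 + q.length = N := by simp [hN]; omega
  have h6 := runs_move_db i u o q [] p.reverse []
  rw [List.append_nil, List.reverse_reverse, List.length_reverse] at h6
  have h7 := runs_lt_part T p N (by omega) i u o q
  have h8 : (seq (emitIdx T .eq x) (push d x)).Runs
      (st i u (o ++ p.bindIdx (idxPart T p.length)) q [] p.reverse []) (idxTime T N + 1)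
      (st i u (o ++ (p ++ [x]).bindIdx (idxPart T p.length)) q [] (p ++ [x]).reverse []) := by
    have h := (runs_emitIdx T .eq x N i u (o ++ p.bindIdx (idxPart T p.length)) q [] p.reverse
      (by simp; omega)).seq (runs_push (Γ := Sym) d x (update_d ..))
    have hk : idxPart T p.length p.length x = AutTable.shiftBits (p.reverse.length * T.numIdx)
        (T.idxBits .eq x) := by
      rw [idxPart, Nat.compare_eq_eq.2 rfl, List.length_reverse]
    rw [List.bindIdx_concat, hk, List.reverse_append, ← List.append_assoc o]
    exact h
  have h9 := runs_gt_part T p q x N (by omega) i u o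
  set o' := o ++ (p ++ x :: q).bindIdx (idxPart T p.length)
  have h10 : (loop b fun y => seq (push a y) (drop d) : StackProg Sym).Runs
      (st i u o' [] q.reverse (p ++ x :: q).reverse []) (q.length * (1 + 1 + 1) + 1)
      (st i u o' q [] (x :: p.reverse) []) := by
    have h := runs_loop b (fun y => seq (push a y) (drop d) : _ → StackProg Sym) q.reverse (1 + 1)
      (fun r s => st i u o' r.reverse s (s ++ x :: p.reverse) [])
      (fun _ _ => rfl) fun r y s hr => ?_
    · simpa using h
    · have h := (runs_push (Γ := Sym) a y (update_a i u o' r.reverse s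
        (y :: s ++ x :: p.reverse) [] _)).seq (runs_drop (Γ := Sym) d (update_d ..))
      rw [List.reverse_append, update_b]
      exact h
  have h11 : (drop d : StackProg Sym).Runs (st i u o' q [] (x :: p.reverse) []) 1
      (st i u o' q [] p.reverse []) := runs_drop (Γ := Sym) d (update_d ..)
  refine (h6.seq <| h7.seq <| h8.seq <| h9.seq <| h10.seq h11).mono ?_
  have e3 := Nat.mul_le_mul_right (idxTime T N + 2) (show p.length ≤ N by omega)
  have e4 := Nat.mul_le_mul_right (idxTime T N + 3) (show q.length ≤ N by omega)
  rw [lettersTime]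
  change _ + (p.length * (idxTime T N + 2) + 1 + (_ + (q.length * (idxTime T N + 3) + 1 + _))) ≤ _
  omega

/-- Write the code of an automaton with the accepting states `F`; the letters are given as
for `letters`. -/
def autom (F : Finset (Fin T.numStates)) (x : Option Bool) : StackProg Sym :=
  seq (emit (T.headBits F)) <|
  seq (perD (List.replicate (rate T) true)) <|
  seq (emit (List.replicate (rate T) true)) <|
  seq (perA (List.replicate (rate T) true)) <|
  seq (emit (constBits T)) (letters T x)

/-- A bound for the running time of `autom`, if there are `N` letters. -/
def automTime (N : ℕ) : ℕ :=
  (T.headBits T.acc).length + (T.headBits Finset.univ).length + 2 * (N * (rate T + 4) + 2) +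
    rate T + (constBits T).length + lettersTime T N

theorem runs_autom (F : Finset (Fin T.numStates)) (hF : F = T.acc ∨ F = Finset.univ)
    (p q : List (Option Bool)) (x : Option Bool) (i u o) :
    (autom T F x).Runs (st i u o q [] p.reverse []) (automTime T (p ++ x :: q).length)
      (st i u (o ++ T.dtaBits (p ++ x :: q) F p.length) q [] p.reverse []) := by
  set N := (p ++ x :: q).length with hN
  have hN' : p.length + 1 + q.length = N := by simp [hN]; omega
  have h1 := runs_emit (T.headBits F) i u o q [] p.reverse []
  set o1 := o ++ T.headBits F
  have h2 := runs_perD (List.replicate (rate T) true) i u o1 q [] p.reverse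
  set rp := (List.replicate p.reverse.length (List.replicate (rate T) true)).flatten
  set rq := (List.replicate q.length (List.replicate (rate T) true)).flatten
  have h3 := runs_emit (List.replicate (rate T) true) i u (o1 ++ rp) q [] p.reverse []
  have h4 := runs_perA (List.replicate (rate T) true) i u
    (o1 ++ rp ++ List.replicate (rate T) true) q [] p.reverse
  have ho : o1 ++ rp ++ List.replicate (rate T) true ++ rq =
      o1 ++ List.replicate (N * rate T) true := by
    simp only [rp, rq, replicate_replicate, List.length_reverse, List.append_assoc,
      List.replicate_append_replicate]
    rw [← hN']
    congr 2
    ring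
  rw [ho] at h4
  have h5 := runs_emit (constBits T) i u (o1 ++ List.replicate (N * rate T) true) q [] p.reverse []
  have h6 := runs_letters T p q x i u (o1 ++ List.replicate (N * rate T) true ++ constBits T)
  have hfin : o1 ++ List.replicate (N * rate T) true ++ constBits T ++
      (p ++ x :: q).bindIdx (idxPart T p.length) = o ++ T.dtaBits (p ++ x :: q) F p.length := by
    simp only [AutTable.dtaBits, o1, constBits, rate, List.append_assoc, hN]
    rfl
  rw [← hfin]
  refine (h1.seq <| h2.seq <| h3.seq <| h4.seq <| h5.seq h6).mono ?_
  have hF' : (T.headBits F).length ≤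
      (T.headBits T.acc).length + (T.headBits Finset.univ).length := by
    rcases hF with rfl | rfl <;> omega
  have e1 := Nat.mul_le_mul_right (rate T + 4) (show p.length ≤ N by omega)
  have e2 := Nat.mul_le_mul_right (rate T + 4) (show q.length ≤ N by omega)
  rw [automTime, List.length_replicate, List.length_reverse, ← hN]
  omega

end RedProg

namespace RedProg

open StackProg RedStack

variable (T : AutTable)

/-- Write the codes of all automata. -/
def automs : StackProg Sym :=
  loop a fun x => seq (autom T T.acc x) (seq (autom T Finset.univ x) (push d x))

theorem runs_automs (W : List (Option Bool)) (i u o) : (automs T).Runs (st i u o W [] [] [])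
    (W.length * (automTime T W.length + (automTime T W.length + 1) + 1) + 1)
    (st i u (o ++ W.bindIdx fun j _ => T.dtaBits W T.acc j ++ T.dtaBits W Finset.univ j)
      [] [] W.reverse []) := by
  set f : ℕ → Option Bool → List Bool :=
    fun j _ => T.dtaBits W T.acc j ++ T.dtaBits W Finset.univ j with hf
  have h := runs_loop a (fun x => seq (autom T T.acc x) (seq (autom T Finset.univ x) (push d x))) W
    (automTime T W.length + (automTime T W.length + 1))
    (fun p q => st i u (o ++ p.bindIdx f) q [] p.reverse []) (fun _ _ => rfl) fun p x q hp => ?_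
  · rw [automs]
    simpa [List.bindIdx] using h
  · have h1 := runs_autom T T.acc (Or.inl rfl) p q x i u (o ++ p.bindIdx f)
    have h2 := runs_autom T Finset.univ (Or.inr rfl) p q x i u
      (o ++ p.bindIdx f ++ T.dtaBits (p ++ x :: q) T.acc p.length)
    have h3 := h1.seq (h2.seq (runs_push (Γ := Sym) d x (update_d ..)))
    rw [hp] at h3
    rw [List.bindIdx_concat, List.reverse_append, update_a]
    simp only [hf, ← List.append_assoc] at h3 ⊢
    exact h3

/-- The arities of the symbols that do not depend on the letters. -/
def arityBits : List Bool :=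
  natBits (T.numRules + 1) ++ natBits 0 ++ (List.replicate T.numRules (natBits 2)).flatten

/-- Write the signature and the number of variables. -/
def header : StackProg Sym :=
  seq (perA (List.replicate T.numIdx true)) <|
  seq (emit (arityBits T)) <|
  seq (perA (List.replicate T.numIdx (natBits 2)).flatten) <|
  seq (perA [true, true]) (emit [false])

/-- The running time of `header`, if there are `N` letters. -/
def headerTime (N : ℕ) : ℕ :=
  (N * (T.numIdx + 4) + 2) + ((arityBits T).length +
    ((N * (T.numIdx * 3 + 4) + 2) + ((N * 6 + 2) + 1)))

theorem runs_header (W : List (Option Bool)) (i u o) : (header T).Runs (st i u o W [] [] [])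
    (headerTime T W.length) (st i u (o ++ T.sigBits W.length) W [] [] []) := by
  have h1 := runs_perA (List.replicate T.numIdx true) i u o W [] []
  set o1 := o ++ (List.replicate W.length (List.replicate T.numIdx true)).flatten
  have h2 := runs_emit (arityBits T) i u o1 W [] [] []
  set o2 := o1 ++ arityBits T
  have h3 := runs_perA (List.replicate T.numIdx (natBits 2)).flatten i u o2 W [] []
  set o3 := o2 ++ (List.replicate W.length (List.replicate T.numIdx (natBits 2)).flatten).flatten
  have h4 := runs_perA [true, true] i u o3 W [] []
  set o4 := o3 ++ (List.replicate W.length [true, true]).flatten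
  have h5 := runs_emit [false] i u o4 W [] [] []
  have ho : o4 ++ [false] = o ++ T.sigBits W.length := by
    have h : (List.replicate W.length [true, true]).flatten = List.replicate (W.length * 2) true :=
      replicate_replicate W.length 2
    simp only [o1, o2, o3, o4, h, replicate_replicate, AutTable.sigBits, arityBits,
      List.append_assoc]
  rw [← ho]
  refine (h1.seq <| h2.seq <| h3.seq <| h4.seq h5).mono (le_of_eq ?_)
  simp [headerTime, natBits]

/-- Write the terms. -/
def terms : StackProg Sym :=
  seq (perA [true]) <|
  seq (emit [true, false]) <|
  seq (loop a fun x => seq (emit ([1, 1, 0].flatMap natBits)) <|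
    seq (perD [true, true]) <| seq (emit ([false] ++ [0, 1].flatMap natBits)) (push d x)) <|
  emit ([1, 1, 0, 1, 1, 1, 0, 3, 0, 3].flatMap natBits)

/-- The running time of `terms`, if there are `N` letters. -/
def termsTime (N : ℕ) : ℕ :=
  (N * 5 + 2) + (2 + ((N * (5 + ((N * 6 + 2) + (4 + 1)) + 1) + 1) + 21))

theorem runs_terms (W : List (Option Bool)) (i u o) : terms.Runs (st i u o W [] [] [])
    (termsTime W.length) (st i u (o ++ AutTable.termBits W) [] [] W.reverse []) := by
  set l1 := [1, 1, 0].flatMap natBits with hl1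
  set l2 := [false] ++ [0, 1].flatMap natBits with hl2
  set f : ℕ → Option Bool → List Bool := fun i _ => l1 ++ (List.replicate (i * 2) true ++ l2)
  have h1 := runs_perA [true] i u o W [] []
  set o1 := o ++ (List.replicate W.length [true]).flatten
  have h2 := runs_emit [true, false] i u o1 W [] [] []
  set o2 := o1 ++ [true, false]
  have h3 : (loop a fun x => seq (emit l1) <| seq (perD [true, true]) <|
      seq (emit l2) (push d x)).Runs (st i u o2 W [] [] [])
      (W.length * (5 + ((W.length * 6 + 2) + (4 + 1)) + 1) + 1)
      (st i u (o2 ++ W.bindIdx f) [] [] W.reverse []) := by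
    have h := runs_loop a (fun x => seq (emit l1) <| seq (perD [true, true]) <|
      seq (emit l2) (push d x)) W (5 + ((W.length * 6 + 2) + (4 + 1)))
      (fun p q => st i u (o2 ++ p.bindIdx f) q [] p.reverse []) (fun _ _ => rfl)
      fun p x q hp => ?_
    · simpa [List.bindIdx] using h
    · have g1 := runs_emit l1 i u (o2 ++ p.bindIdx f) q [] p.reverse []
      have g2 := runs_perD [true, true] i u (o2 ++ p.bindIdx f ++ l1) q [] p.reverse
      have g3 := runs_emit l2 i u (o2 ++ p.bindIdx f ++ l1 ++
        (List.replicate p.reverse.length [true, true]).flatten) q [] p.reverse []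
      have g4 := runs_push (Γ := Sym) d x (update_d i u (o2 ++ p.bindIdx f ++ l1 ++
        (List.replicate p.reverse.length [true, true]).flatten ++ l2) q [] p.reverse [] _)
      have hk : o2 ++ p.bindIdx f ++ l1 ++ (List.replicate p.reverse.length [true, true]).flatten ++
          l2 = o2 ++ (p ++ [x]).bindIdx f := by
        have h : (List.replicate p.length [true, true]).flatten =
          List.replicate (p.length * 2) true := replicate_replicate p.length 2
        simp only [List.bindIdx_concat, List.length_reverse, h, f, List.append_assoc]
      rw [hk] at g3 g4
      rw [update_a, List.reverse_append]
      refine (g1.seq (g2.seq (g3.seq g4))).mono ?_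
      have h5 : l1.length = 5 := rfl
      have h6 : l2.length = 4 := rfl
      have h7 : p.length ≤ W.length := by rw [← hp]; simp
      simp only [h5, h6, List.length_reverse, List.length_cons, List.length_nil]
      omega
  set o3 := o2 ++ W.bindIdx f
  have h4 := runs_emit ([1, 1, 0, 1, 1, 1, 0, 3, 0, 3].flatMap natBits) i u o3 [] [] W.reverse []
  have ho : o3 ++ [1, 1, 0, 1, 1, 1, 0, 3, 0, 3].flatMap natBits = o ++ AutTable.termBits W := by
    have h : (List.replicate W.length [true]).flatten = List.replicate W.length true := by simp
    simp only [o1, o2, o3, h, AutTable.termBits, List.append_assoc]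
    rfl
  rw [← ho]
  exact h1.seq <| h2.seq <| h3.seq h4

/-- Add `|b| + 2` letters `none` to the stack `a`. -/
def grow : StackProg Sym :=
  seq (push a none) <|
  seq (push a none) <|
  seq (loop b fun y => seq (push d y) (push a none)) (loop d fun y => push b y)

theorem runs_grow (i u o l le) (k : ℕ) : grow.Runs (st i u o (List.replicate k none) l [] le)
    (1 + (1 + ((l.length * 3 + 1) + (l.length * 2 + 1))))
    (st i u o (List.replicate (k + (l.length + 2)) none) l [] le) := by
  have h1 := runs_push (Γ := Sym) a none (update_a i u o (List.replicate k none) l [] le _)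
  have h2 := runs_push (Γ := Sym) a none (update_a i u o (List.replicate (k + 1) none) l [] le _)
  have h3 : (loop b fun y => seq (push d y) (push a none) : StackProg Sym).Runs
      (st i u o (List.replicate (k + 2) none) l [] le) (l.length * 3 + 1)
      (st i u o (List.replicate (k + (l.length + 2)) none) [] l.reverse le) := by
    have h := runs_loop b (fun y => seq (push d y) (push a none) : _ → StackProg Sym) l 2
      (fun p q => st i u o (List.replicate (k + (p.length + 2)) none) q p.reverse le)
      (fun _ _ => rfl) fun p y q hp => ?_
    · simpa using h
    · have h := (runs_push (Γ := Sym) d y (update_d i u o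
        (List.replicate (k + (p.length + 2)) none) q p.reverse le _)).seq
        (runs_push (Γ := Sym) a none (update_a ..))
      rw [List.reverse_append, update_b, List.length_append, List.length_singleton,
        Nat.add_right_comm, ← Nat.add_assoc, List.replicate_succ]
      exact h
  have h4 := runs_move_db i u o (List.replicate (k + (l.length + 2)) none) [] l.reverse le
  rw [List.reverse_reverse, List.append_nil, List.length_reverse] at h4
  exact h1.seq (h2.seq (h3.seq h4))

/-- Multiply the number of letters on the stack `a` by `|b| + 2`. -/
def mulStep : StackProg Sym :=
  seq (loop a fun x => push e x) (loop e fun _ => grow)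

theorem runs_mulStep (i u o l) (k : ℕ) : mulStep.Runs (st i u o (List.replicate k none) l [] [])
    (k * (l.length * 5 + 7) + 2) (st i u o (List.replicate (k * (l.length + 2)) none) l [] []) := by
  have h1 : (loop a fun x => push e x : StackProg Sym).Runs
      (st i u o (List.replicate k none) l [] []) (k * 2 + 1)
      (st i u o [] l [] (List.replicate k none)) := by
    have h := runs_loop a (fun x => push e x : _ → StackProg Sym) (List.replicate k none) 1
      (fun p q => st i u o q l [] p.reverse) (fun _ _ => rfl) fun p x q _ => runs_push _ _ (by simp)
    simpa using h
  have h2 : (loop e fun _ => grow : StackProg Sym).Runs (st i u o [] l [] (List.replicate k none))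
      (k * ((1 + (1 + ((l.length * 3 + 1) + (l.length * 2 + 1)))) + 1) + 1)
      (st i u o (List.replicate (k * (l.length + 2)) none) l [] []) := by
    have h := runs_loop e (fun _ => grow : _ → StackProg Sym) (List.replicate k none)
      (1 + (1 + ((l.length * 3 + 1) + (l.length * 2 + 1))))
      (fun p q => st i u o (List.replicate (p.length * (l.length + 2)) none) l [] q)
      (fun _ _ => rfl) fun p x q _ => ?_
    · simpa using h
    · have h := runs_grow i u o l q (p.length * (l.length + 2))
      rwa [← Nat.succ_mul, ← Nat.add_one, ← List.length_singleton (a := x), ← List.length_append,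
        ← update_e i u o _ l [] (x :: q)] at h
  exact (h1.seq h2).mono (le_of_eq (by ring))

/-- Perform the step `mulStep` repeatedly. -/
def mulSteps : ℕ → StackProg Sym
  | 0 => skip
  | k + 1 => seq (mulSteps k) mulStep

theorem runs_mulSteps (i u o l) (k : ℕ) : (mulSteps k).Runs (st i u o [none] l [] [])
    (k * ((l.length + 2) ^ k * (l.length * 5 + 7) + 2))
    (st i u o (List.replicate ((l.length + 2) ^ k) none) l [] []) := by
  induction k with
  | zero => exact (runs_skip _).mono (Nat.zero_le _)
  | succ k ih =>
    refine (ih.seq (runs_mulStep i u o l _)).mono ?_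
    have h : (l.length + 2) ^ k ≤ (l.length + 2) ^ (k + 1) :=
      Nat.pow_le_pow_right (by omega) (by omega)
    rw [Nat.succ_mul]
    gcongr

/-- The letters for the input `w`: its bits, followed by `(|w| + 2) ^ k` letters `none`. The number
of letters is the number of bits of the counters. -/
def lettersOf (k : ℕ) (w : List Bool) : List (Option Bool) :=
  w.map some ++ List.replicate ((w.length + 2) ^ k) none

/-- Compute the letters from the input. -/
def setup (k : ℕ) : StackProg Sym :=
  seq (loop inp fun x => push b (some x)) <|
  seq (push a none) <|
  seq (mulSteps k) (loop b fun x => push a x)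

/-- The running time of `setup`, on an input of length `n`. -/
def setupTime (k n : ℕ) : ℕ :=
  (n * 2 + 1) + (1 + (k * ((n + 2) ^ k * (n * 5 + 7) + 2) + (n * 2 + 1)))

theorem runs_setup (k : ℕ) (w : List Bool) (u o) : (setup k).Runs (st w u o [] [] [] [])
    (setupTime k w.length) (st [] u o (lettersOf k w) [] [] []) := by
  have h1 : (loop inp fun x => push b (some x) : StackProg Sym).Runs (st w u o [] [] [] [])
      (w.length * 2 + 1) (st [] u o [] (w.map some).reverse [] []) := by
    have h := runs_loop inp (fun x => push b (some x) : _ → StackProg Sym) w 1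
      (fun p q => st q u o [] (p.map some).reverse [] []) (fun _ _ => rfl)
      fun p x q _ => runs_push _ _ (by simp)
    simpa using h
  have h2 := runs_push (Γ := Sym) a none (update_a [] u o [] (w.map some).reverse [] [] _)
  have h3 := runs_mulSteps [] u o (w.map some).reverse k
  have h4 := runs_move_ba [] u o (List.replicate ((w.length + 2) ^ k) none) (w.map some).reverse
    [] []
  simp only [List.length_reverse, List.length_map, List.reverse_reverse] at h3 h4
  exact h1.seq (h2.seq (h3.seq h4))

/-- The program that writes the code of the instance for an input, except that it writes it on the
stack `rev`. -/
def main (k : ℕ) : StackProg Sym :=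
  seq (setup k) <|
  seq (header T) <|
  seq (automs T) <|
  seq (loop d fun x => push a x) <|
  seq terms (loop d fun _ => skip)

/-- The running time of `main` on an input of length `n`, if there are `N` letters. -/
def mainTime (k n N : ℕ) : ℕ :=
  setupTime k n + (headerTime T N + ((N * (automTime T N + (automTime T N + 1) + 1) + 1) +
    ((N * 2 + 1) + (termsTime N + (N * 1 + 1)))))

theorem runs_main (k : ℕ) (w : List Bool) (u) (hW : 2 ≤ (lettersOf k w).length) :
    (main T k).Runs (st w u [] [] [] [] []) (mainTime T k w.length (lettersOf k w).length)
      (st [] u (T.inst (lettersOf k w) hW).encode [] [] [] []) := by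
  have h1 := runs_setup k w u []
  set W := lettersOf k w
  have h2 := runs_header T W [] u []
  set o2 := [] ++ T.sigBits W.length
  have h3 := runs_automs T W [] u o2
  set o3 := o2 ++ W.bindIdx fun j _ => T.dtaBits W T.acc j ++ T.dtaBits W Finset.univ j
  have h4 := runs_move_da [] u o3 [] [] W.reverse []
  rw [List.append_nil, List.reverse_reverse, List.length_reverse] at h4
  have h5 := runs_terms W [] u o3
  have h6 : (loop d fun _ => skip : StackProg Sym).Runs
      (st [] u (o3 ++ AutTable.termBits W) [] [] W.reverse []) (W.length * 1 + 1)
      (st [] u (o3 ++ AutTable.termBits W) [] [] [] []) := by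
    have h := runs_loop d (fun _ => skip : _ → StackProg Sym) W.reverse 0
      (fun p q => st [] u (o3 ++ AutTable.termBits W) [] [] q []) (fun _ _ => rfl)
      fun p x q _ => by rw [update_d]; exact runs_skip _
    simpa using h
  have ho : o3 ++ AutTable.termBits W = (T.inst W hW).encode := by
    rw [AutTable.encode_inst]
    simp only [o2, o3, List.nil_append, List.append_assoc]
  rw [← ho]
  exact h1.seq <| h2.seq <| h3.seq <| h4.seq <| h5.seq h6

end RedProg

/-- In `n` steps a stack grows by at most `n`. -/
theorem StackProg.Exec.length_le {K : Type} {Γ : K → Type} [DecidableEq K] {p : StackProg Γ}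
    {S S' : ∀ k, List (Γ k)} {n : ℕ} (h : p.Exec S n S') (k : K) :
    (S' k).length ≤ (S k).length + n := by
  induction h with
  | skip => exact le_rfl
  | push k' a S =>
    by_cases hk : k = k'
    · subst hk; simp
    · simp [hk]
  | drop k' S =>
    by_cases hk : k = k'
    · subst hk; simp; omega
    · simp [hk]
  | seq _ _ ih ih' => omega
  | loop_nil => omega
  | @loop_cons k' S a l S' S'' n n' body h _ _ ih ih' =>
    have h1 : (Function.update S k' l k).length ≤ (S k).length := by
      by_cases hk : k = k'
      · subst hk; simp [h]
      · simp [hk]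
    omega

namespace RedProg

open StackProg RedStack

variable (T : AutTable)

/-- The program that maps an input to the code of the instance. -/
def reduction (k : ℕ) : StackProg Sym :=
  seq (main T k) (loop rev fun x => push out x)

theorem runs_reduction (k : ℕ) (w : List Bool) (hW : 2 ≤ (lettersOf k w).length) :
    (reduction T k).Runs (st w [] [] [] [] [] [])
      (mainTime T k w.length (lettersOf k w).length * 3 + 1)
      (st [] (T.inst (lettersOf k w) hW).encode [] [] [] [] []) := by
  have h1 := runs_main T k w [] hW
  obtain ⟨m, hm, h⟩ := h1
  have h2 := h.length_le rev
  simp only [st_rev, List.length_reverse, List.length_nil, Nat.zero_add] at h2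
  set o := (T.inst (lettersOf k w) hW).encode
  have h3 : (loop rev fun x => push out x : StackProg Sym).Runs (st [] [] o [] [] [] [])
      (o.length * 2 + 1) (st [] o [] [] [] [] []) := by
    have h := runs_loop rev (fun x => push out x : _ → StackProg Sym) o.reverse 1
      (fun p q => st [] p.reverse q.reverse [] [] [] []) (fun p q => by simp)
      fun p x q _ => runs_push _ _ (by simp)
    simpa using h
  exact (Runs.seq ⟨m, hm, h⟩ h3).mono (by omega)

/-- A polynomial that bounds the running time of the reduction. -/
noncomputable def timePoly (k : ℕ) : Polynomial ℕ :=
  let X : Polynomial ℕ := Polynomial.X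
  let c : ℕ → Polynomial ℕ := Polynomial.C
  let N := X + (X + 2) ^ k
  let idx := c (idxBound T) * (N * (c T.numIdx + 4) + 2) + c (idxBound T)
  let lets := (N * 2 + 1) + (N * (idx + 2) + 1) + (idx + 1) +
    (N * (idx + 3) + 1) + (N * 3 + 1) + 1
  let aut := c (T.headBits T.acc).length + c (T.headBits Finset.univ).length +
    2 * (N * (c (rate T) + 4) + 2) + c (rate T) + c (constBits T).length + lets
  let set := (X * 2 + 1) + (1 + (c k * ((X + 2) ^ k * (X * 5 + 7) + 2) + (X * 2 + 1)))
  let head := (N * (c T.numIdx + 4) + 2) + (c (arityBits T).length +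
    ((N * (c T.numIdx * 3 + 4) + 2) + ((N * 6 + 2) + 1)))
  let ter := (N * 5 + 2) + (2 + ((N * (5 + ((N * 6 + 2) + (4 + 1)) + 1) + 1) + 21))
  (set + (head + ((N * (aut + (aut + 1) + 1) + 1) + ((N * 2 + 1) + (ter + (N * 1 + 1)))))) * 3 + 1

theorem eval_timePoly (k n : ℕ) :
    (timePoly T k).eval n = mainTime T k n (n + (n + 2) ^ k) * 3 + 1 := by
  simp only [timePoly, Polynomial.eval_add, Polynomial.eval_mul, Polynomial.eval_pow,
    Polynomial.eval_X, Polynomial.eval_C, Polynomial.eval_ofNat, Polynomial.eval_one, mainTime,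
    setupTime, headerTime, termsTime, automTime, lettersTime, idxTime]

theorem two_le_length_lettersOf {k : ℕ} (hk : k ≠ 0) (w : List Bool) :
    2 ≤ (lettersOf k w).length := by
  have h := Nat.pow_le_pow_right (n := w.length + 2) (by omega) (Nat.one_le_iff_ne_zero.2 hk)
  rw [pow_one] at h
  simp only [lettersOf, List.length_append, List.length_map, List.length_replicate]
  omega

/-- The instance for the letters of the input is computable in polynomial time. -/
theorem computableInPolyTime_inst {k : ℕ} (hk : k ≠ 0) :
    Nonempty (Turing.TM2ComputableInPolyTime (id : List Bool → List Bool) ConstrainedTerms.encode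
      fun w => T.inst (lettersOf k w) (two_le_length_lettersOf hk w)) := by
  refine (reduction T k).computableInPolyTime (k₀ := inp) (k₁ := out) (Equiv.refl Bool)
    (Equiv.refl Bool) _ _ (timePoly T k) fun w => ?_
  have h := runs_reduction T k w (two_le_length_lettersOf hk w)
  have hN : (lettersOf k w).length = w.length + (w.length + 2) ^ k := by
    simp [lettersOf]
  rw [hN, ← eval_timePoly] at h
  convert h using 1
  · funext k
    cases k <;> simp
  · funext k
    cases k <;> simp

end RedProg

/-! ### The reduction -/

theorem BinaryTree.eval_map {α α' β β' : Type} (f : α → α') (g : β → β') (c : β) (c' : β')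
    (δ : α → β → β → β) (δ' : α' → β' → β' → β') (hc : c' = g c)
    (hδ : ∀ x a b, δ' (f x) (g a) (g b) = g (δ x a b)) (t : BinaryTree α) :
    (t.map f).eval c' δ' = g (t.eval c δ) := by
  induction t with
  | nil => exact hc
  | node x l r hl hr =>
    rw [BinaryTree.map, BinaryTree.eval, BinaryTree.eval, hl, hr, hδ]

namespace StackMachine

variable (M : StackMachine)

/-- The numbers of the states. -/
noncomputable def stateEquiv :
    Option (Local M.Q M.K) ≃ Fin (Fintype.card (Option (Local M.Q M.K))) :=
  Fintype.equivFin _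

/-- The numbers of the rules. -/
noncomputable def ruleEquiv : Rule M.K ≃ Fin (Fintype.card (Rule M.K)) :=
  Fintype.equivFin _

/-- The numbers of the symbols with the same index. -/
noncomputable def idxEquiv : Option (Bool × Bool) ≃ Fin (Fintype.card (Option (Bool × Bool))) :=
  Fintype.equivFin _

open Classical in
/-- The automata that check the proof trees, with numbers for their states and symbols. A state is
accepting if it does not stem from a proof that `M` rejects. -/
noncomputable def table : AutTable where
  numStates := Fintype.card (Option (Local M.Q M.K))
  numRules := Fintype.card (Rule M.K)
  numIdx := Fintype.card (Option (Bool × Bool))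
  numIdx_pos := Fintype.card_pos
  leaf := M.stateEquiv (some M.leafLocal)
  rule r a b := M.stateEquiv ((M.stateEquiv.symm a).bind fun x =>
    (M.stateEquiv.symm b).bind fun y => M.applyRule (M.ruleEquiv.symm r) x y)
  idx cmp l s a b := M.stateEquiv ((M.stateEquiv.symm a).bind fun x =>
    (M.stateEquiv.symm b).bind fun _ => M.applyIdx cmp l (idxEquiv.symm s) x)
  acc := Finset.univ.filter fun q =>
    ∀ x, M.stateEquiv.symm q = some x → x.kind ≠ .state M.reject

/-- The numbers of the labels of the proof trees. -/
noncomputable def labelEquiv (N : ℕ) : Label M.K N ≃ Fin (M.table.numRules + N * M.table.numIdx) :=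
  (Equiv.sumCongr M.ruleEquiv
    ((Equiv.prodCongr (Equiv.refl _) idxEquiv).trans finProdFinEquiv)).trans finSumFinEquiv

theorem trans_table (W : List (Option Bool)) (j : Fin W.length) (g : Label M.K W.length)
    (a b : Option (Local M.Q M.K)) :
    M.table.trans W j (M.labelEquiv _ g) (M.stateEquiv a) (M.stateEquiv b) =
      M.stateEquiv (M.localStep W.get j g a b) := by
  obtain r | ⟨i, s⟩ := g
  · refine (congrFun₂ (M.table.trans_castAdd W j (M.ruleEquiv r)) _ _).trans ?_
    simp [table, localStep]
  · refine (congrFun₂ (M.table.trans_natAdd W j i (idxEquiv s)) _ _).trans ?_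
    simp [table, localStep]
    rfl

theorem isRegular_inst_iff (W : List (Option Bool)) (hW : 2 ≤ W.length) :
    IsRegularTreeLanguage (M.table.inst W hW).language ↔
      ∀ t : BinaryTree (Label M.K W.length), ∃ j,
        ∀ x, M.localEval W.get j t = some x → x.kind ≠ .state M.reject := by
  have hacc : ∀ y, M.stateEquiv y ∈ M.table.acc ↔ ∀ x, y = some x → x.kind ≠ .state M.reject := by
    intro y
    classical
    refine Finset.mem_filter.trans ?_
    rw [Equiv.symm_apply_apply]
    simp
  have heval : ∀ (t : BinaryTree (Label M.K W.length)) (j : Fin W.length),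
      (t.map (M.labelEquiv _)).eval M.table.leaf (M.table.trans W j) =
        M.stateEquiv (M.localEval W.get j t) := fun t j =>
    BinaryTree.eval_map _ _ _ _ _ _ rfl (M.trans_table W j) t
  have hmap : Function.Surjective (BinaryTree.map (M.labelEquiv W.length)) := fun t =>
    ⟨t.map (M.labelEquiv W.length).symm, by
      rw [← BinaryTree.comp_map, Equiv.self_comp_symm, BinaryTree.id_map]⟩
  have hleaf : M.table.leaf ∈ M.table.acc := by
    refine (hacc _).2 fun x hx => ?_
    obtain rfl := Option.some.inj hx
    simp [leafLocal, Local.mk']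
  rw [AutTable.inst, isRegular_coverInst_iff _ hW _ _ _ hleaf]
  refine hmap.forall.trans ?_
  simp only [heval]
  exact forall_congr' fun t => exists_congr fun j => hacc _

end StackMachine

theorem Polynomial.exists_eval_le_add_two_pow (p : Polynomial ℕ) :
    ∃ k ≠ 0, ∀ n, p.eval n ≤ (n + 2) ^ k := by
  induction p using Polynomial.induction_on' with
  | add p q hp hq =>
    obtain ⟨k, hk, hp⟩ := hp
    obtain ⟨l, -, hq⟩ := hq
    refine ⟨max k l + 1, by omega, fun n => ?_⟩
    have h1 := (hp n).trans (Nat.pow_le_pow_right (by omega) (le_max_left k l))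
    have h2 := (hq n).trans (Nat.pow_le_pow_right (by omega) (le_max_right k l))
    rw [Polynomial.eval_add, pow_succ]
    nlinarith [Nat.zero_le ((n + 2) ^ max k l * n)]
  | monomial i c =>
    refine ⟨i + c + 1, by omega, fun n => ?_⟩
    rw [Polynomial.eval_monomial, add_assoc, pow_add, mul_comm]
    refine Nat.mul_le_mul (Nat.pow_le_pow_left (by omega) i) ?_
    exact (Nat.le_succ c).trans ((Nat.lt_pow_self (by omega)).le)

theorem mainTheorem1 : EXPTIMEHard RITRC := by
  intro L hL
  obtain ⟨M, p, hM⟩ := exists_stackMachine hL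
  obtain ⟨k, hk, hp⟩ := p.exists_eval_le_add_two_pow
  refine ⟨_, RedProg.computableInPolyTime_inst M.table hk, fun w => ?_⟩
  set W := RedProg.lettersOf k w with hWdef
  have hlen : W.length = w.length + (w.length + 2) ^ k := by simp [hWdef, RedProg.lettersOf]
  have hW : ∀ i : Fin W.length, W.get i = w[(i : ℕ)]? := by
    rintro ⟨i, hi⟩
    by_cases h : i < w.length
    · simp [hWdef, RedProg.lettersOf, h]
    · simp [hWdef, RedProg.lettersOf, List.getElem_append, h]
  have hpos : 0 < (w.length + 2) ^ k := by positivity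
  refine (hM w).1.trans (Iff.trans (Iff.symm ?_) (M.isRegular_inst_iff W _).symm)
  refine M.forall_tree_iff hW (by omega) fun h => ?_
  obtain ⟨T, hT, hr⟩ := (hM w).2 h
  refine ⟨T, hT.trans_le (Nat.pow_le_pow_right (by omega) ?_), hr⟩
  exact (hp w.length).trans (by omega)
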